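/- Let $N_B\ge 1$, let $B$ be a Hermitian $N_B\times N_B$ matrix with input index $1$ and output index $N_B$, let $J'\in\mathbb{R}$, and put $C_\pm=B\pm J'|N_B\rangle\langle N_B|$. Call an eigenvalue of $C_\pm$ supported if it has an eigenvector whose component at index $1$ is nonzero. Assume that no real number is a supported eigenvalue of both $C_+$ and $C_-$ (this holds in particular if $C_+$ and $C_-$ have no common eigenvalue). Then there are an integer $N_A\ge 1$, a real symmetric tridiagonal $N_A\times N_A$ matrix $A$ with positive off-diagonal couplings, and a real number $J>0$ such that the following Hermitian matrix $H$ of size $2(N_A+N_B)$ has perfect encoded state transfer. The matrix $H$ has diagonal blocks, in this order, $$S_{\mathcal A}AS_{\mathcal A},\qquad B,\qquad S_{\mathcal B}BS_{\mathcal B},\qquad A,$$ where $S_{\mathcal A}$, $S_{\mathcal B}$ reverse the order of the basis vectors; the last index of each of the first three blocks is coupled to the first index of the next block, with the strengths $J$, $J'$, $J$ respectively, and all other entries outside the diagonal blocks are $0$. Perfect encoded state transfer means: there are a time $t_0>0$, a phase $\phi\in\mathbb{R}$ and a unit vector $|\Psi\rangle\in\mathbb{C}^{2(N_A+N_B)}$,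 supported on the first $N_A$ indices (the chain attached to the input), such that $$e^{-iHt_0}|\Psi\rangle=e^{i\phi}S_{\mathcal H}|\Psi\rangle,$$ where $S_{\mathcal H}$ is the reversal of all $2(N_A+N_B)$ indices, so that the state arrives exactly on the opposite chain. -/

import Mathlib

/-- The projector `|n⟩⟨n|` on the last index of `Fin n` (the `OUT` vertex). -/
def outProj (n : ℕ) : Matrix (Fin n) (Fin n) ℂ :=
  Matrix.diagonal fun i => if i.val + 1 = n then 1 else 0

/-- `C_± = B ± J' |N_B⟩⟨N_B|`: `Cplus B J'` is `C_+`. -/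
def Cplus {n : ℕ} (B : Matrix (Fin n) (Fin n) ℂ) (J' : ℝ) : Matrix (Fin n) (Fin n) ℂ :=
  B + (J' : ℂ) • outProj n

/-- `C_± = B ± J' |N_B⟩⟨N_B|`: `Cminus B J'` is `C_-`. -/
def Cminus {n : ℕ} (B : Matrix (Fin n) (Fin n) ℂ) (J' : ℝ) : Matrix (Fin n) (Fin n) ℂ :=
  B - (J' : ℂ) • outProj n

/-- The eigenvalues (of a Hermitian matrix) that have an eigenvector with nonzero component at the
first index, i.e. the spectrum that is left when the eigenvectors without support on the `IN`
vertex have been removed. It is contained in the full spectrum. -/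
def supportedSpectrum {n : ℕ} (C : Matrix (Fin n) (Fin n) ℂ) : Set ℝ :=
  {l | ∃ v : Fin n → ℂ, C.mulVec v = (l : ℂ) • v ∧ ∃ i : Fin n, i.val = 0 ∧ v i ≠ 0}

/-- Real symmetric tridiagonal matrices with positive couplings. -/
structure IsTridiagonalChain {n : ℕ} (A : Matrix (Fin n) (Fin n) ℝ) : Prop where
  symm : A.IsSymm
  tridiagonal : ∀ i j : Fin n, i.val + 1 < j.val → A i j = 0
  coupling_pos : ∀ i j : Fin n, i.val + 1 = j.val → 0 < A i j

/-- The `m × n` block `c |m⟩⟨1|`, whose only entry is `c` in the bottom left corner. -/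
def link (m n : ℕ) (c : ℝ) : Matrix (Fin m) (Fin n) ℂ :=
  Matrix.of fun i j => if i.val + 1 = m ∧ j.val = 0 then (c : ℂ) else 0

/-- `S M S` for the reversal `S = ∑ |i⟩⟨n+1-i|`. -/
def reversed {n : ℕ} (M : Matrix (Fin n) (Fin n) ℂ) : Matrix (Fin n) (Fin n) ℂ :=
  M.submatrix Fin.rev Fin.rev

/-- The vertices of the extended system, in the order: mirrored extension, given system,
mirrored given system, extension. -/
abbrev Site (a b : ℕ) : Type := (Fin a ⊕ Fin b) ⊕ (Fin b ⊕ Fin a)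

/-- The matrix `H` with diagonal blocks `S A S`, `B`, `S B S`, `A`, in which consecutive blocks are
coupled, last index to first index, with strengths `J`, `J'`, `J`. -/
def extendedH {a b : ℕ} (A : Matrix (Fin a) (Fin a) ℝ) (B : Matrix (Fin b) (Fin b) ℂ)
    (J J' : ℝ) : Matrix (Site a b) (Site a b) ℂ :=
  Matrix.fromBlocks
    (Matrix.fromBlocks (reversed (A.map Complex.ofReal)) (link a b J) (link a b J).transpose B)
    (Matrix.fromBlocks 0 0 (link b b J') 0)
    (Matrix.fromBlocks 0 0 (link b b J') 0).transpose
    (Matrix.fromBlocks (reversed B) (link b a J) (link b a J).transpose (A.map Complex.ofReal))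

/-- The mirror symmetry of the vertices of the extended system: the reversal of their order. -/
def mirror {a b : ℕ} : Site a b → Site a b
  | .inl (.inl i) => .inr (.inr i.rev)
  | .inl (.inr i) => .inr (.inl i.rev)
  | .inr (.inl i) => .inl (.inr i.rev)
  | .inr (.inr i) => .inl (.inl i.rev)

/-- The encoding region: the vertices of the chain attached to the `IN` vertex. Its mirror image,
the other chain, is the decoding region. -/
def encodingRegion (a b : ℕ) : Set (Site a b) :=
  {s | ∃ i : Fin a, s = .inl (.inl i)}

/-- Perfect encoded state transfer: some normalised single-excitation state `ψ` that is supported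
on the encoding region evolves under `e^{-i H t₀}`, for some time `t₀ > 0`, into its mirror image,
up to a phase. -/
def PerfectEncodedTransfer {a b : ℕ} (H : Matrix (Site a b) (Site a b) ℂ) : Prop :=
  ∃ (t₀ φ : ℝ) (ψ : Site a b → ℂ), 0 < t₀ ∧ ∑ s, ‖ψ s‖ ^ 2 = 1 ∧
    (∀ s, s ∉ encodingRegion a b → ψ s = 0) ∧
    (NormedSpace.exp ((-(Complex.I * (t₀ : ℂ))) • H)).mulVec ψ =
      Complex.exp (Complex.I * (φ : ℂ)) • fun s => ψ (mirror s)

/-!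
The mirror symmetry splits `H` into its restrictions to the even and the odd vectors. In both
cases this is the chain `A` attached to the input vertex of a smaller system, with matrix `C_+`
and `C_-` respectively (`extendedH_mulVec_withParity`). A state `x` on the chain is the mean of
its even and its odd extension, so it is transferred perfectly at time `t` as soon as `e^{-i t λ}
= 1` for all eigenvalues `λ` occurring in `x` for `C_+`, and `e^{-i t λ} = -1` for those occurring
for `C_-`.

Let `e` be the basis vector at the free end of the chain, whose length is `m + 1`. A nonzero
polynomial of degree at most `m`, evaluated at the Hamiltonian, takes `e` to a nonzero vector on
the chain, which is the same for `C_+` and `C_-` (`exists_aeval_halfEnd_eq`). In this way `m`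
unwanted eigenvalues can be removed from the state. The eigenvalues occurring in `e` are the zeros
of the secular polynomials `E_± = P D_± - Q N_±` (`halfEnd_secularPoly`), where `N_± / D_±` is the
Stieltjes transform of the spectral measure of `C_±` at the input vertex, `P` is the last
orthogonal polynomial of the chain, and `Q` is the one before, times the squared coupling. It
remains to find a chain for which all but `m` zeros of `E_+` and `E_-` are even, respectively odd,
multiples of `π / t` (`exists_commensurate_chain`).

Let `n` be the total number of supported eigenvalues of `C_+` and `C_-`, take `m = n`, and begin
with any chain of length `m + 1`. The zeros of `E_±` are real and simple
(`card_roots_secularPoly`). As the supported spectra are disjoint, `D_+ N_- - D_- N_+` is a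
nonzero polynomial; it vanishes at the common zeros of `E_+` and `E_-`, so there are fewer than
`n` of these (`card_common_roots_lt`). Hence there are `n` zeros of `E_+` that include all the
common ones; without them, `2 (m + 1)` distinct zeros remain. That these are zeros of `E_±` is a
system of `2 (m + 1)` linear equations for the `2 (m + 1)` free coefficients of `P` and `Q`. It is
nonsingular (`interpMatrix_det_ne_zero`), so the zeros may be moved by small amounts and `P`, `Q`
follow continuously (`exists_interpolation`). Since the pairs `(P, Q)` that come from chains form
an open set (`eventually_exists_orthPoly`), the zeros can be moved to multiples of `π / t` of the
desired parity once `t` is large.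
-/

/-! ### Orthogonal polynomials of a tridiagonal chain -/

open Polynomial in
/-- The monic orthogonal polynomials with diagonal coefficients `α` and off-diagonal coefficients
`w`: `orthPoly α w k` is the characteristic polynomial of the symmetric `k × k` tridiagonal matrix
with diagonal `α 0, …, α (k - 1)` and squared couplings `w 0, …, w (k - 2)`. -/
noncomputable def orthPoly (α w : ℕ → ℝ) : ℕ → ℝ[X]
  | 0 => 1
  | 1 => X - C (α 0)
  | k + 2 => (X - C (α (k + 1))) * orthPoly α w (k + 1) - C (w k) * orthPoly α w k

section OrthPoly

open Polynomial Filter Topology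

lemma orthPoly_add_two (α w : ℕ → ℝ) (k : ℕ) :
    orthPoly α w (k + 2)
      = (X - C (α (k + 1))) * orthPoly α w (k + 1) - C (w k) * orthPoly α w k := by
  rw [orthPoly]

lemma orthPoly_congr {α w α' w' : ℕ → ℝ} {m : ℕ} (hα : ∀ j < m, α j = α' j)
    (hw : ∀ j, j + 1 < m → w j = w' j) : orthPoly α w m = orthPoly α' w' m := by
  induction m using Nat.strong_induction_on with
  | _ m ih =>
    match m with
    | 0 => simp [orthPoly]
    | 1 => simp [orthPoly, hα 0]
    | k + 2 =>
      rw [orthPoly_add_two, orthPoly_add_two, hα (k + 1) (by lia), hw k (by lia),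
        ih (k + 1) (by lia) (fun j hj => hα j (by lia)) (fun j hj => hw j (by lia)),
        ih k (by lia) (fun j hj => hα j (by lia)) (fun j hj => hw j (by lia))]

lemma orthPoly_monic_natDegree (α w : ℕ → ℝ) (m : ℕ) :
    (orthPoly α w m).Monic ∧ (orthPoly α w m).natDegree = m := by
  induction m using Nat.strong_induction_on with
  | _ m ih =>
    match m with
    | 0 => simp [orthPoly]
    | 1 => simpa [orthPoly] using monic_X_sub_C (α 0)
    | k + 2 =>
      obtain ⟨h1, d1⟩ := ih (k + 1) (by lia)
      obtain ⟨h0, d0⟩ := ih k (by lia)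
      have hM : ((X - C (α (k + 1))) * orthPoly α w (k + 1)).Monic := (monic_X_sub_C _).mul h1
      have hd : ((X - C (α (k + 1))) * orthPoly α w (k + 1)).natDegree = k + 2 := by
        rw [(monic_X_sub_C _).natDegree_mul h1, d1, natDegree_X_sub_C]; ring
      have hlt : (C (w k) * orthPoly α w k).natDegree
          < ((X - C (α (k + 1))) * orthPoly α w (k + 1)).natDegree := by
        rw [hd]
        exact (natDegree_C_mul_le _ _).trans_lt (by lia)
      rw [orthPoly_add_two]
      exact ⟨hM.sub_of_left (degree_lt_degree hlt), by
        rw [natDegree_sub_eq_left_of_natDegree_lt hlt, hd]⟩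

lemma orthPoly_monic (α w : ℕ → ℝ) (m : ℕ) : (orthPoly α w m).Monic :=
  (orthPoly_monic_natDegree α w m).1

lemma orthPoly_natDegree (α w : ℕ → ℝ) (m : ℕ) : (orthPoly α w m).natDegree = m :=
  (orthPoly_monic_natDegree α w m).2

lemma orthPoly_isCoprime {α w : ℕ → ℝ} (hw : ∀ k, 0 < w k) (m : ℕ) :
    IsCoprime (orthPoly α w (m + 1)) (orthPoly α w m) := by
  induction m with
  | zero => simpa [orthPoly] using isCoprime_one_right
  | succ k ih =>
    have hu : IsUnit (C (-w k)) := isUnit_C.2 (by simpa using (hw k).ne')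
    have h : IsCoprime (C (-w k) * orthPoly α w k) (orthPoly α w (k + 1)) :=
      (isCoprime_mul_unit_left_left hu _ _).2 ih.symm
    have := h.add_mul_left_left (X - C (α (k + 1)))
    rw [orthPoly_add_two]
    have e : (X - C (α (k + 1))) * orthPoly α w (k + 1) - C (w k) * orthPoly α w k
        = C (-w k) * orthPoly α w k + orthPoly α w (k + 1) * (X - C (α (k + 1))) := by
      rw [C_neg]; ring
    rwa [e]

lemma orthPoly_wronskian_pos {α w : ℕ → ℝ} (hw : ∀ k, 0 < w k) (m : ℕ) (x : ℝ) :
    0 < (derivative (orthPoly α w (m + 1))).eval x * (orthPoly α w m).eval x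
      - (orthPoly α w (m + 1)).eval x * (derivative (orthPoly α w m)).eval x := by
  induction m with
  | zero => simp [orthPoly]
  | succ k ih =>
    rw [orthPoly_add_two]
    simp only [derivative_sub, derivative_mul, derivative_X, derivative_C, eval_sub, eval_mul,
      eval_add, eval_X, eval_C, eval_one, eval_zero]
    nlinarith [mul_pos (hw k) ih, sq_nonneg ((orthPoly α w (k + 1)).eval x)]

lemma orthPoly_im_pos {α w : ℕ → ℝ} (hw : ∀ k, 0 < w k) (m : ℕ) {z : ℂ} (hz : z.im ≠ 0) :
    0 < z.im * (aeval z (orthPoly α w (m + 1))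
      * (starRingEnd ℂ) (aeval z (orthPoly α w m))).im := by
  induction m with
  | zero => simpa [orthPoly] using mul_self_pos.2 hz
  | succ k ih =>
    rw [orthPoly_add_two]
    simp only [map_sub, map_mul, aeval_X, aeval_C, Complex.coe_algebraMap]
    generalize aeval z (orthPoly α w (k + 1)) = p at ih ⊢
    generalize aeval z (orthPoly α w k) = q at ih ⊢
    simp only [Complex.mul_im, Complex.sub_im, Complex.sub_re, Complex.mul_re, Complex.ofReal_re,
      Complex.ofReal_im, Complex.conj_re, Complex.conj_im] at ih ⊢
    nlinarith [mul_pos (hw k) ih, mul_self_pos.2 hz, mul_nonneg (mul_self_nonneg z.im)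
      (add_nonneg (mul_self_nonneg p.re) (mul_self_nonneg p.im))]

/-- The pairs `(p_{m+1}, w_m p_m)` form an open set, among all pairs of a monic polynomial of
degree `m + 1` and a polynomial of degree at most `m`: the coefficients `α`, `w` are recovered by
the Euclidean algorithm, whose steps are continuous as long as the leading coefficients stay
positive. -/
lemma eventually_exists_orthPoly {β : Type*} {l : Filter β} (m : ℕ) (α w : ℕ → ℝ)
    (hw : ∀ k, 0 < w k) (P Q : β → ℝ[X])
    (hP : ∀ᶠ t in l, (P t).Monic ∧ (P t).natDegree = m + 1) (hQ : ∀ᶠ t in l, (Q t).natDegree ≤ m)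
    (hPc : ∀ k, Tendsto (fun t => (P t).coeff k) l (𝓝 ((orthPoly α w (m + 1)).coeff k)))
    (hQc : ∀ k, Tendsto (fun t => (Q t).coeff k) l (𝓝 ((C (w m) * orthPoly α w m).coeff k))) :
    ∀ᶠ t in l, ∃ α' w' : ℕ → ℝ, (∀ k, 0 < w' k) ∧ P t = orthPoly α' w' (m + 1) ∧
      Q t = C (w' m) * orthPoly α' w' m := by
  induction m generalizing P Q with
  | zero =>
    have h0 : ∀ᶠ t in l, 0 < (Q t).coeff 0 := by
      have := hQc 0
      simp only [orthPoly, mul_one, coeff_C_zero] at this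
      exact this.eventually (lt_mem_nhds (hw 0))
    filter_upwards [h0, hP, hQ] with t h0 hP hQ
    refine ⟨fun _ => -(P t).coeff 0, fun _ => (Q t).coeff 0, fun _ => h0, ?_, ?_⟩
    · have := hP.1.as_sum
      rw [hP.2] at this
      rw [this]
      simp [orthPoly]
    · simpa [orthPoly] using eq_C_of_natDegree_le_zero hQ
  | succ m ih =>
    set p := orthPoly α w with hp
    have hlead : (p (m + 1)).coeff (m + 1) = 1 := by
      have := orthPoly_monic α w (m + 1)
      rwa [Monic, leadingCoeff, orthPoly_natDegree] at this
    have hc : Tendsto (fun t => (Q t).coeff (m + 1)) l (𝓝 (w (m + 1))) := by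
      have := hQc (m + 1)
      rwa [coeff_C_mul, hlead, mul_one] at this
    -- The first step of the Euclidean algorithm, from the pair `(P, Q)` to the pair `(Q₁, R)`.
    set c : β → ℝ := fun t => (Q t).coeff (m + 1) with hcdef
    set Q₁ : β → ℝ[X] := fun t => C (c t)⁻¹ * Q t with hQ₁
    set a : β → ℝ := fun t => (Q₁ t).coeff m - (P t).coeff (m + 1) with ha
    set R : β → ℝ[X] := fun t => (X - C (a t)) * Q₁ t - P t with hR
    have hcpos : ∀ᶠ t in l, 0 < c t := hc.eventually (lt_mem_nhds (hw _))
    have hQ₁c : ∀ k, Tendsto (fun t => (Q₁ t).coeff k) l (𝓝 ((p (m + 1)).coeff k)) := by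
      intro k
      have := (hc.inv₀ (hw (m + 1)).ne').mul (hQc k)
      rw [coeff_C_mul, inv_mul_cancel_left₀ (hw (m + 1)).ne'] at this
      simpa only [hQ₁, coeff_C_mul] using this
    have hQ₁m : ∀ᶠ t in l, (Q₁ t).Monic ∧ (Q₁ t).natDegree = m + 1 := by
      filter_upwards [hcpos, hQ] with t hct hQt
      have hle : (Q₁ t).natDegree ≤ m + 1 := (natDegree_C_mul_le _ _).trans hQt
      have h1 : (Q₁ t).coeff (m + 1) = 1 := by
        simp only [hQ₁, coeff_C_mul]
        exact inv_mul_cancel₀ hct.ne'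
      exact ⟨monic_of_natDegree_le_of_coeff_eq_one _ hle h1,
        le_antisymm hle (le_natDegree_of_ne_zero (by simp [h1]))⟩
    have hac : Tendsto a l (𝓝 (α (m + 1))) := by
      have := (hQ₁c m).sub (hPc (m + 1))
      convert this using 2
      rw [hp, orthPoly_add_two, sub_mul, coeff_sub, coeff_sub, coeff_X_mul, coeff_C_mul, ← hp,
        hlead, coeff_C_mul, coeff_eq_zero_of_natDegree_lt (p := p m) (n := m + 1)
        (by rw [hp, orthPoly_natDegree]; lia)]
      ring
    have hRc : ∀ k, Tendsto (fun t => (R t).coeff k) l (𝓝 ((C (w m) * p m).coeff k)) := by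
      intro k
      have e : C (w m) * p m = (X - C (α (m + 1))) * p (m + 1) - p (m + 1 + 1) := by
        rw [hp, orthPoly_add_two]; ring
      rw [e]
      cases k with
      | zero =>
        simp only [hR, sub_mul, coeff_sub, mul_coeff_zero, coeff_X_zero, zero_mul]
        exact (tendsto_const_nhds.sub (by simpa using hac.mul (hQ₁c 0))).sub (hPc 0)
      | succ k =>
        simp only [hR, sub_mul, coeff_sub, coeff_C_mul, coeff_X_mul]
        exact ((hQ₁c k).sub (hac.mul (hQ₁c (k + 1)))).sub (hPc (k + 1))
    have hRd : ∀ᶠ t in l, (R t).natDegree ≤ m := by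
      filter_upwards [hQ₁m, hP] with t h1 h2
      rw [natDegree_le_iff_coeff_eq_zero]
      intro N hN
      obtain ⟨N, rfl⟩ : ∃ k, N = k + 1 := ⟨N - 1, by lia⟩
      simp only [hR, sub_mul, coeff_sub, coeff_C_mul, coeff_X_mul]
      have e1 : (Q₁ t).coeff (m + 1) = 1 := by
        have := h1.1; rwa [Monic, leadingCoeff, h1.2] at this
      have e2 : (P t).coeff (m + 2) = 1 := by
        have := h2.1; rwa [Monic, leadingCoeff, h2.2] at this
      rcases (by lia : N = m ∨ N = m + 1 ∨ m + 1 < N) with rfl | rfl | h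
      · rw [e1]; simp only [ha]; ring
      · rw [e1, e2, coeff_eq_zero_of_natDegree_lt (p := Q₁ t) (by lia)]; ring
      · rw [coeff_eq_zero_of_natDegree_lt (p := Q₁ t) (n := N) (by lia),
          coeff_eq_zero_of_natDegree_lt (p := Q₁ t) (by lia),
          coeff_eq_zero_of_natDegree_lt (p := P t) (by lia)]; ring
    filter_upwards [ih Q₁ R hQ₁m hRd hQ₁c hRc, hcpos] with t ⟨α', w', hw', e1, e2⟩ hct
    have c1 : orthPoly (Function.update α' (m + 1) (a t)) (Function.update w' (m + 1) (c t))
        (m + 1) = orthPoly α' w' (m + 1) :=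
      orthPoly_congr (fun j hj => Function.update_of_ne (by lia) _ _)
        (fun j hj => Function.update_of_ne (by lia) _ _)
    have c0 : orthPoly (Function.update α' (m + 1) (a t)) (Function.update w' (m + 1) (c t))
        m = orthPoly α' w' m :=
      orthPoly_congr (fun j hj => Function.update_of_ne (by lia) _ _)
        (fun j hj => Function.update_of_ne (by lia) _ _)
    refine ⟨Function.update α' (m + 1) (a t), Function.update w' (m + 1) (c t), ?_, ?_, ?_⟩
    · intro k
      by_cases hk : k = m + 1
      · subst hk; simpa using hct
      · rw [Function.update_of_ne hk]; exact hw' k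
    · rw [orthPoly_add_two, c1, c0, Function.update_self, Function.update_of_ne (by lia),
        ← e1, ← e2]
      simp only [hR]; ring
    · rw [c1, Function.update_self, ← e1]
      simp only [hQ₁]
      rw [← mul_assoc, ← C_mul, mul_inv_cancel₀ hct.ne', C_1, one_mul]

end OrthPoly

/-! ### Finitely supported measures and the secular equation -/

open Polynomial in
/-- The monic polynomial with simple roots at the points of `Λ`. -/
noncomputable def nodePoly (Λ : Finset ℝ) : ℝ[X] := ∏ l ∈ Λ, (X - C l)

open Polynomial in
/-- The numerator of the Stieltjes transform `∑ ρ l / (X - l)` over the denominator `nodePoly Λ`. -/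
noncomputable def stieltjesNum (Λ : Finset ℝ) (ρ : ℝ → ℝ) : ℝ[X] :=
  ∑ l ∈ Λ, C (ρ l) * nodePoly (Λ.erase l)

/-- The numerator `P D - Q N` of `P / Q - N / D`. When `P` and `Q` are the last two orthogonal
polynomials of a chain, `Q` being multiplied by the squared coupling to a system in which the
contact vertex has the spectral measure with Stieltjes transform `N / D`, its zeros are the
eigenvalues of the coupled system whose eigenvectors have a component on the chain. -/
noncomputable def secularPoly (D N P Q : Polynomial ℝ) : Polynomial ℝ := P * D - Q * N

section Secular

open Polynomial

lemma nodePoly_monic (Λ : Finset ℝ) : (nodePoly Λ).Monic :=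
  monic_prod_of_monic _ _ fun _ _ => monic_X_sub_C _

lemma nodePoly_natDegree (Λ : Finset ℝ) : (nodePoly Λ).natDegree = Λ.card := by
  rw [nodePoly, natDegree_prod_of_monic _ _ fun l _ => monic_X_sub_C l]
  simp

lemma nodePoly_eq_mul_erase {Λ : Finset ℝ} {l : ℝ} (hl : l ∈ Λ) :
    nodePoly Λ = (X - C l) * nodePoly (Λ.erase l) :=
  (Finset.mul_prod_erase Λ _ hl).symm

lemma nodePoly_eval_eq_zero_iff (Λ : Finset ℝ) (x : ℝ) : (nodePoly Λ).eval x = 0 ↔ x ∈ Λ := by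
  simp [nodePoly, eval_prod, Finset.prod_eq_zero_iff, sub_eq_zero]

lemma stieltjesNum_degree_lt (Λ : Finset ℝ) (ρ : ℝ → ℝ) :
    (stieltjesNum Λ ρ).degree < Λ.card := by
  refine (degree_sum_le _ _).trans_lt ((Finset.sup_lt_iff (WithBot.bot_lt_coe _)).2 fun l hl => ?_)
  refine degree_le_natDegree.trans_lt (WithBot.coe_lt_coe.2 ?_)
  refine (natDegree_C_mul_le _ _).trans_lt ?_
  rw [nodePoly_natDegree]
  exact Finset.card_erase_lt_of_mem hl

lemma stieltjesNum_eval_ne_zero {Λ : Finset ℝ} {ρ : ℝ → ℝ} (hρ : ∀ l ∈ Λ, 0 < ρ l) {x : ℝ}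
    (hx : x ∈ Λ) : (stieltjesNum Λ ρ).eval x ≠ 0 := by
  rw [stieltjesNum, eval_finsetSum, Finset.sum_eq_single_of_mem x hx]
  · rw [eval_mul, eval_C]
    exact mul_ne_zero (hρ x hx).ne' (by simp [nodePoly_eval_eq_zero_iff])
  · intro l _ hlx
    rw [eval_mul, (nodePoly_eval_eq_zero_iff _ _).2 (Finset.mem_erase.2 ⟨hlx.symm, hx⟩), mul_zero]

lemma stieltjes_wronskian_nonpos {Λ : Finset ℝ} {ρ : ℝ → ℝ} (hρ : ∀ l ∈ Λ, 0 < ρ l) (x : ℝ) :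
    (derivative (stieltjesNum Λ ρ)).eval x * (nodePoly Λ).eval x
      - (stieltjesNum Λ ρ).eval x * (derivative (nodePoly Λ)).eval x ≤ 0 := by
  rw [stieltjesNum, derivative_sum, eval_finsetSum, eval_finsetSum, Finset.sum_mul,
    Finset.sum_mul, ← Finset.sum_sub_distrib]
  refine Finset.sum_nonpos fun l hl => ?_
  rw [nodePoly_eq_mul_erase hl]
  simp only [derivative_sub, derivative_mul, derivative_X, derivative_C, eval_sub, eval_mul,
    eval_add, eval_X, eval_C, eval_one, eval_zero]
  nlinarith [mul_nonneg (hρ l hl).le (sq_nonneg ((nodePoly (Λ.erase l)).eval x))]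

lemma stieltjes_im_nonpos {Λ : Finset ℝ} {ρ : ℝ → ℝ} (hρ : ∀ l ∈ Λ, 0 < ρ l) (z : ℂ) :
    z.im * (aeval z (stieltjesNum Λ ρ) * (starRingEnd ℂ) (aeval z (nodePoly Λ))).im ≤ 0 := by
  rw [stieltjesNum, map_sum, Finset.sum_mul, Complex.im_sum, Finset.mul_sum]
  refine Finset.sum_nonpos fun l hl => ?_
  rw [nodePoly_eq_mul_erase hl]
  simp only [map_sub, map_mul, aeval_X, aeval_C, Complex.coe_algebraMap]
  generalize aeval z (nodePoly (Λ.erase l)) = q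
  simp only [Complex.mul_im, Complex.sub_im, Complex.sub_re, Complex.mul_re, Complex.ofReal_re,
    Complex.ofReal_im, Complex.conj_re, Complex.conj_im]
  nlinarith [mul_nonneg (mul_nonneg (hρ l hl).le (mul_self_nonneg z.im))
      (add_nonneg (mul_self_nonneg q.re) (mul_self_nonneg q.im))]

lemma secularPoly_monic_natDegree {D N P Q : ℝ[X]} {m : ℕ} (hD : D.Monic)
    (hN : N.degree < D.degree) (hP : P.Monic) (hPd : P.natDegree = m + 1) (hQ : Q.natDegree ≤ m) :
    (secularPoly D N P Q).Monic ∧ (secularPoly D N P Q).natDegree = m + 1 + D.natDegree := by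
  have hlt : (Q * N).degree < (P * D).degree := by
    rw [degree_mul, degree_mul]
    have hQP : Q.degree ≤ P.degree := by
      rw [degree_eq_natDegree hP.ne_zero, hPd]
      exact degree_le_of_natDegree_le (by lia)
    rcases eq_or_ne Q 0 with rfl | h0
    · rw [degree_zero, WithBot.bot_add, ← degree_mul]
      exact bot_lt_iff_ne_bot.2 (degree_ne_bot.2 (hP.mul hD).ne_zero)
    · exact WithBot.add_lt_add_of_le_of_lt (degree_ne_bot.2 h0) hQP hN
  refine ⟨(hP.mul hD).sub_of_left hlt, ?_⟩
  rw [secularPoly, natDegree_eq_of_degree_eq (degree_sub_eq_left_of_degree_lt hlt),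
    hP.natDegree_mul hD, hPd]

/-- The division-free form of `p / q = n / d`, in which `q` or `d` may vanish. -/
lemma exists_smul_of_cross_eq_zero {K : Type*} [Field K] {p q d n : K} (h : p * d = q * n)
    (hdn : d ≠ 0 ∨ n ≠ 0) : ∃ s, p = s * n ∧ q = s * d := by
  by_cases hd : d = 0
  · have hn : n ≠ 0 := by simpa [hd] using hdn
    have hq : q = 0 := by simpa [hd, hn, eq_comm] using h
    exact ⟨p / n, by field_simp, by simp [hq, hd]⟩
  · exact ⟨q / d, by field_simp; exact h, by field_simp⟩

/-- The zeros of the secular polynomial are real and simple: the quotient `P / Q` of consecutive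
orthogonal polynomials increases strictly along the real line and maps the upper half plane to
itself, while the Stieltjes transform `N / D` has the opposite monotonicity. -/
lemma card_roots_secularPoly {α w : ℕ → ℝ} (hw : ∀ k, 0 < w k) (m : ℕ) {Λ : Finset ℝ} {ρ : ℝ → ℝ}
    (hρ : ∀ l ∈ Λ, 0 < ρ l) :
    (secularPoly (nodePoly Λ) (stieltjesNum Λ ρ) (orthPoly α w (m + 1))
      (C (w m) * orthPoly α w m)).roots.toFinset.card = m + 1 + Λ.card := by
  set D := nodePoly Λ with hD
  set N := stieltjesNum Λ ρ with hN
  set P := orthPoly α w (m + 1) with hP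
  set q := orthPoly α w m with hq
  obtain ⟨hE, hEd⟩ := secularPoly_monic_natDegree (D := D) (N := N) (Q := C (w m) * q)
    (nodePoly_monic Λ)
    (by rw [degree_eq_natDegree (nodePoly_monic Λ).ne_zero, nodePoly_natDegree]
        exact stieltjesNum_degree_lt Λ ρ)
    (orthPoly_monic α w (m + 1)) (orthPoly_natDegree α w (m + 1))
    ((natDegree_C_mul_le _ _).trans (orthPoly_natDegree α w m).le)
  rw [← hP] at hE hEd
  set E := secularPoly D N P (C (w m) * q) with hEdef
  have hsplit : E.Splits := by
    refine Splits.of_splits_map (algebraMap ℝ ℂ) (IsAlgClosed.splits _) fun z hz => ?_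
    suffices h : z.im = 0 from ⟨z.re, Complex.ext (by simp) (by simp [h])⟩
    by_contra hne
    have h0 : aeval z E = 0 := by
      rw [mem_roots (hE.map _).ne_zero, IsRoot.def, eval_map_algebraMap] at hz
      exact hz
    simp only [hEdef, secularPoly, map_sub, map_mul, sub_eq_zero, aeval_C,
      Complex.coe_algebraMap] at h0
    have hDz : aeval z D ≠ 0 := by
      intro h
      simp only [hD, nodePoly, map_prod, Finset.prod_eq_zero_iff] at h
      obtain ⟨l, -, hl⟩ := h
      simp only [map_sub, aeval_X, aeval_C, Complex.coe_algebraMap, sub_eq_zero] at hl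
      exact hne (by simp [hl])
    obtain ⟨s, h1, h2⟩ := exists_smul_of_cross_eq_zero h0 (Or.inl hDz)
    have hpos := mul_pos (hw m) (orthPoly_im_pos (α := α) hw m hne)
    have hneg := stieltjes_im_nonpos hρ z
    rw [← hD, ← hN] at hneg
    rw [← hP, ← hq] at hpos
    have key : w m * (z.im * (aeval z P * (starRingEnd ℂ) (aeval z q)).im)
        = Complex.normSq s * (z.im * (aeval z N * (starRingEnd ℂ) (aeval z D)).im) := by
      have h3 : aeval z P * (starRingEnd ℂ) ((w m : ℂ) * aeval z q)
          = Complex.normSq s * (aeval z N * (starRingEnd ℂ) (aeval z D)) := by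
        rw [h1, h2, map_mul, Complex.normSq_eq_conj_mul_self]; ring
      have h4 := congrArg Complex.im h3
      rw [map_mul, Complex.conj_ofReal, mul_left_comm, Complex.im_ofReal_mul,
        Complex.im_ofReal_mul] at h4
      rw [mul_left_comm, h4]; ring
    rw [key] at hpos
    nlinarith [Complex.normSq_nonneg s]
  have hnodup : E.roots.Nodup := by
    rw [Multiset.nodup_iff_count_le_one]
    intro x
    rw [count_roots]
    by_contra! hcon
    obtain ⟨h0, hd⟩ := (one_lt_rootMultiplicity_iff_isRoot hE.ne_zero).1 hcon
    simp only [IsRoot.def, hEdef, secularPoly, derivative_sub, derivative_mul, derivative_C,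
      eval_sub, eval_mul, eval_add, eval_C, zero_mul, zero_add] at hd h0
    rw [sub_eq_zero] at h0
    have hDN : D.eval x ≠ 0 ∨ N.eval x ≠ 0 := by
      by_cases h : x ∈ Λ
      · exact Or.inr (stieltjesNum_eval_ne_zero hρ h)
      · exact Or.inl fun h' => h ((nodePoly_eval_eq_zero_iff Λ x).1 h')
    obtain ⟨s, h1, h2⟩ := exists_smul_of_cross_eq_zero h0 hDN
    have hpos := mul_pos (hw m) (orthPoly_wronskian_pos (α := α) hw m x)
    have hneg := stieltjes_wronskian_nonpos hρ x
    rw [← hD, ← hN] at hneg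
    rw [← hP, ← hq] at hpos
    have key : w m * ((derivative P).eval x * q.eval x - P.eval x * (derivative q).eval x)
        = s ^ 2 * ((derivative N).eval x * D.eval x - N.eval x * (derivative D).eval x) := by
      linear_combination s * hd
        + ((derivative P).eval x + s * (derivative N).eval x) * h2
        - (w m * (derivative q).eval x + s * (derivative D).eval x) * h1
    rw [key] at hpos
    nlinarith [sq_nonneg s]
  rw [Multiset.toFinset_card_of_nodup hnodup, ← hsplit.natDegree_eq_card_roots, hEd, hD,
    nodePoly_natDegree]

end Secular

/-! ### Perturbing the interpolation conditions -/

section Interpolation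

open Polynomial Filter Topology

lemma eval_ofFn {n : ℕ} (c : Fin n → ℝ) (x : ℝ) :
    (ofFn n c).eval x = ∑ k : Fin n, x ^ (k : ℕ) * c k := by
  rw [ofFn_eq_sum_monomial, eval_finsetSum]
  exact Finset.sum_congr rfl fun k _ => by rw [eval_monomial, mul_comm]

/-- The linear system `p (y i) D i (y i) - q (y i) N i (y i) = 0`, `i : ι`, for the coefficients of
two polynomials `p`, `q` of degree less than `n`. -/
noncomputable def interpMatrix {ι : Type*} {n : ℕ} (D N : ι → ℝ[X]) (e : ι ≃ Fin n ⊕ Fin n)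
    (y : ι → ℝ) : Matrix ι ι ℝ :=
  Matrix.of fun i j => Sum.elim (fun k : Fin n => y i ^ (k : ℕ) * (D i).eval (y i))
    (fun k : Fin n => -(y i ^ (k : ℕ) * (N i).eval (y i))) (e j)

lemma interpMatrix_mulVec {ι : Type*} [Fintype ι] {n : ℕ} (D N : ι → ℝ[X])
    (e : ι ≃ Fin n ⊕ Fin n) (y u : ι → ℝ) (i : ι) :
    (interpMatrix D N e y).mulVec u i
      = (ofFn n fun k => u (e.symm (Sum.inl k))).eval (y i) * (D i).eval (y i)
        - (ofFn n fun k => u (e.symm (Sum.inr k))).eval (y i) * (N i).eval (y i) := by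
  rw [Matrix.mulVec, dotProduct,
    ← e.symm.sum_comp (fun j => interpMatrix D N e y i j * u j), Fintype.sum_sum_type, eval_ofFn,
    eval_ofFn, Finset.sum_mul, Finset.sum_mul, sub_eq_add_neg, ← Finset.sum_neg_distrib]
  congr 1 <;> refine Finset.sum_congr rfl fun k _ => ?_ <;> simp [interpMatrix] <;> ring

/-- A solution `(P, Q)` makes the homogeneous system nonsingular: for a solution `(p, q)` of lower
degree, `p Q - q P` vanishes at all `2 n` nodes, so that `P ∣ p`. -/
lemma interpMatrix_det_ne_zero {ι : Type*} [Fintype ι] [DecidableEq ι] {n : ℕ} {D N : ι → ℝ[X]}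
    (e : ι ≃ Fin n ⊕ Fin n) {x : ι → ℝ} (hx : Function.Injective x) {P Q : ℝ[X]} (hP : P.Monic)
    (hPd : P.natDegree = n) (hQ : Q.natDegree < n) (hPQ : IsCoprime P Q)
    (h0 : ∀ i, P.eval (x i) * (D i).eval (x i) = Q.eval (x i) * (N i).eval (x i))
    (hne : ∀ i, (D i).eval (x i) ≠ 0 ∨ (N i).eval (x i) ≠ 0) :
    (interpMatrix D N e x).det ≠ 0 := by
  intro hdet
  obtain ⟨u, hu, hMu⟩ := Matrix.exists_mulVec_eq_zero_iff.2 hdet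
  set p := ofFn n fun k => u (e.symm (Sum.inl k)) with hp
  set q := ofFn n fun k => u (e.symm (Sum.inr k)) with hq
  have hn : 1 ≤ n := by lia
  have hpd : p.natDegree < n := ofFn_natDegree_lt hn _
  have hqd : q.natDegree < n := ofFn_natDegree_lt hn _
  have hcross : p * Q = q * P := by
    have hd : (p * Q - q * P).natDegree < 2 * n := by
      refine (natDegree_sub_le _ _).trans_lt (max_lt ?_ ?_)
      · exact natDegree_mul_le.trans_lt (by lia)
      · exact natDegree_mul_le.trans_lt (by lia)
    refine sub_eq_zero.1 (eq_zero_of_natDegree_lt_card_of_eval_eq_zero _ hx (fun i => ?_)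
      (hd.trans_eq ?_))
    · have h1 : p.eval (x i) * (D i).eval (x i) = q.eval (x i) * (N i).eval (x i) := by
        have := congrFun hMu i
        rw [interpMatrix_mulVec] at this
        exact sub_eq_zero.1 this
      obtain ⟨s, h2, h3⟩ := exists_smul_of_cross_eq_zero (h0 i) (hne i)
      obtain ⟨r, h4, h5⟩ := exists_smul_of_cross_eq_zero h1 (hne i)
      rw [eval_sub, eval_mul, eval_mul, h2, h3, h4, h5]; ring
    · rw [Fintype.card_congr e, Fintype.card_sum, Fintype.card_fin]; ring
  have hp0 : p = 0 := by
    refine eq_zero_of_dvd_of_natDegree_lt (hPQ.dvd_of_dvd_mul_right ⟨q, ?_⟩) (hpd.trans_eq hPd.symm)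
    rw [hcross, mul_comm]
  have hq0 : q = 0 := by
    rw [hp0, zero_mul, eq_comm] at hcross
    exact (mul_eq_zero.1 hcross).resolve_right hP.ne_zero
  refine hu (funext fun j => ?_)
  obtain ⟨s, rfl⟩ := e.symm.surjective j
  rcases s with k | k
  · have := ofFn_coeff_eq_val_of_lt (fun k => u (e.symm (Sum.inl k))) k.2
    rw [← hp, hp0] at this
    exact this.symm
  · have := ofFn_coeff_eq_val_of_lt (fun k => u (e.symm (Sum.inr k))) k.2
    rw [← hq, hq0] at this
    exact this.symm

lemma continuous_interpMatrix {ι : Type*} {n : ℕ} (D N : ι → ℝ[X]) (e : ι ≃ Fin n ⊕ Fin n) :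
    Continuous (interpMatrix D N e) := by
  refine continuous_matrix fun i j => ?_
  have hD : Continuous fun y : ι → ℝ => (D i).eval (y i) :=
    (D i).continuous.comp (continuous_apply i)
  have hN : Continuous fun y : ι → ℝ => (N i).eval (y i) :=
    (N i).continuous.comp (continuous_apply i)
  simp only [interpMatrix, Matrix.of_apply]
  rcases e j with k | k
  · exact ((continuous_apply i).pow _).mul hD
  · exact (((continuous_apply i).pow _).mul hN).neg

/-- If a pair `(P, Q)` satisfies as many secular equations, at distinct nodes `x`, as it has free
coefficients, then the nodes can be moved and `(P, Q)` follows continuously. -/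
lemma exists_interpolation {ι : Type*} [Fintype ι] {m : ℕ}
    (hcard : Fintype.card ι = 2 * (m + 1)) {D N : ι → ℝ[X]} {x : ι → ℝ}
    (hx : Function.Injective x) {P Q : ℝ[X]} (hP : P.Monic) (hPd : P.natDegree = m + 1)
    (hQ : Q.natDegree ≤ m) (hPQ : IsCoprime P Q)
    (h0 : ∀ i, P.eval (x i) * (D i).eval (x i) = Q.eval (x i) * (N i).eval (x i))
    (hne : ∀ i, (D i).eval (x i) ≠ 0 ∨ (N i).eval (x i) ≠ 0)
    {β : Type*} {l : Filter β} {y : β → ι → ℝ} (hy : Tendsto y l (𝓝 x)) :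
    ∃ P' Q' : β → ℝ[X], (∀ t, (P' t).Monic ∧ (P' t).natDegree = m + 1) ∧
      (∀ t, (Q' t).natDegree ≤ m) ∧
      (∀ k, Tendsto (fun t => (P' t).coeff k) l (𝓝 (P.coeff k))) ∧
      (∀ k, Tendsto (fun t => (Q' t).coeff k) l (𝓝 (Q.coeff k))) ∧
      ∀ᶠ t in l, ∀ i, (secularPoly (D i) (N i) (P' t) (Q' t)).eval (y t i) = 0 := by
  classical
  obtain ⟨e⟩ : Nonempty (ι ≃ Fin (m + 1) ⊕ Fin (m + 1)) := by
    rw [← Fintype.card_eq, hcard, Fintype.card_sum, Fintype.card_fin]; ring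
  have hdet := interpMatrix_det_ne_zero e hx hP hPd (by lia) hPQ h0 hne
  set rhs : (ι → ℝ) → ι → ℝ := fun y i => -(y i ^ (m + 1) * (D i).eval (y i)) with hrhs
  have hrhsc : Continuous rhs := continuous_pi fun i =>
    (((continuous_apply i).pow _).mul ((D i).continuous.comp (continuous_apply i))).neg
  have hA := continuous_interpMatrix D N e
  -- Cramer's rule; where the determinant vanishes, `sol` is a junk value.
  set sol : (ι → ℝ) → ι → ℝ := fun y =>
    (interpMatrix D N e y).det⁻¹ • (interpMatrix D N e y).adjugate.mulVec (rhs y) with hsol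
  have hsolc : ContinuousAt sol x :=
    (hA.matrix_det.continuousAt.inv₀ hdet).smul
      (hA.matrix_adjugate.matrix_mulVec hrhsc).continuousAt
  have hinv : ∀ z, (interpMatrix D N e z).det ≠ 0 → ∀ u, (interpMatrix D N e z).mulVec u = rhs z →
      sol z = u := by
    intro z hz u hu
    simp only [hsol]
    rw [← hu, Matrix.mulVec_mulVec, Matrix.adjugate_mul, Matrix.smul_mulVec, Matrix.one_mulVec,
      smul_smul, inv_mul_cancel₀ hz, one_smul]
  have hsolve : ∀ z, (interpMatrix D N e z).det ≠ 0 →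
      (interpMatrix D N e z).mulVec (sol z) = rhs z := by
    intro z hz
    simp only [hsol]
    rw [Matrix.mulVec_smul, Matrix.mulVec_mulVec, Matrix.mul_adjugate, Matrix.smul_mulVec,
      Matrix.one_mulVec, smul_smul, inv_mul_cancel₀ hz, one_smul]
  set u₀ : ι → ℝ := fun j => Sum.elim (fun k : Fin (m + 1) => P.coeff k)
    (fun k : Fin (m + 1) => Q.coeff k) (e j) with hu₀
  have hPsplit : P = X ^ (m + 1) + ofFn (m + 1) fun k => u₀ (e.symm (Sum.inl k)) := by
    ext k
    rw [coeff_add, coeff_X_pow]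
    rcases lt_trichotomy k (m + 1) with h | h | h
    · rw [ofFn_coeff_eq_val_of_lt _ h, if_neg h.ne]; simp [hu₀]
    · have := hP.coeff_natDegree
      rw [hPd] at this
      rw [ofFn_coeff_eq_zero_of_ge _ h.ge, if_pos h, h, this, add_zero]
    · rw [ofFn_coeff_eq_zero_of_ge _ h.le, if_neg h.ne',
        coeff_eq_zero_of_natDegree_lt (by lia), add_zero]
  have hQsplit : Q = ofFn (m + 1) fun k => u₀ (e.symm (Sum.inr k)) := by
    ext k
    rcases lt_or_ge k (m + 1) with h | h
    · rw [ofFn_coeff_eq_val_of_lt _ h]; simp [hu₀]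
    · rw [ofFn_coeff_eq_zero_of_ge _ h, coeff_eq_zero_of_natDegree_lt (by lia)]
  have hsolx : sol x = u₀ := by
    refine hinv x hdet u₀ (funext fun i => ?_)
    rw [interpMatrix_mulVec, ← hQsplit, eq_sub_of_add_eq' hPsplit.symm, eval_sub, eval_pow,
      eval_X]
    simp only [hrhs]
    linear_combination h0 i
  have hlim : Tendsto (fun t => sol (y t)) l (𝓝 u₀) := hsolx ▸ hsolc.tendsto.comp hy
  have hlim' : ∀ s, Tendsto (fun t => sol (y t) (e.symm s)) l (𝓝 (u₀ (e.symm s))) :=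
    fun s => (tendsto_pi_nhds.1 hlim) (e.symm s)
  have hofFn : ∀ r : Fin (m + 1) → Fin (m + 1) ⊕ Fin (m + 1), ∀ k,
      Tendsto (fun t => (ofFn (m + 1) fun j => sol (y t) (e.symm (r j))).coeff k) l
        (𝓝 ((ofFn (m + 1) fun j => u₀ (e.symm (r j))).coeff k)) := by
    intro r k
    rcases lt_or_ge k (m + 1) with h | h
    · simp only [ofFn_coeff_eq_val_of_lt _ h]
      exact hlim' _
    · simp only [ofFn_coeff_eq_zero_of_ge _ h]
      exact tendsto_const_nhds
  have hdeg : ∀ c : Fin (m + 1) → ℝ, (ofFn (m + 1) c).natDegree < m + 1 :=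
    fun c => ofFn_natDegree_lt (by lia) c
  refine ⟨fun t => X ^ (m + 1) + ofFn (m + 1) fun k => sol (y t) (e.symm (Sum.inl k)),
    fun t => ofFn (m + 1) fun k => sol (y t) (e.symm (Sum.inr k)), fun t => ?_,
    fun t => Nat.lt_succ_iff.1 (hdeg _), fun k => ?_, fun k => ?_, ?_⟩
  · have hlt : (ofFn (m + 1) fun k => sol (y t) (e.symm (Sum.inl k))).natDegree
        < (X ^ (m + 1) : ℝ[X]).natDegree := by rw [natDegree_X_pow]; exact hdeg _
    exact ⟨(monic_X_pow _).add_of_left (degree_lt_degree hlt), by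
      rw [natDegree_add_eq_left_of_natDegree_lt hlt, natDegree_X_pow]⟩
  · conv_rhs => rw [hPsplit]
    simp only [coeff_add]
    exact tendsto_const_nhds.add (hofFn Sum.inl k)
  · conv_rhs => rw [hQsplit]
    exact hofFn Sum.inr k
  · have hev : ∀ᶠ t in l, (interpMatrix D N e (y t)).det ≠ 0 :=
      hy.eventually (hA.matrix_det.continuousAt.eventually_ne hdet)
    filter_upwards [hev] with t ht i
    have := congrFun (hsolve _ ht) i
    rw [interpMatrix_mulVec] at this
    simp only [hrhs] at this
    rw [secularPoly, eval_sub, eval_mul, eval_mul, eval_add, eval_pow, eval_X]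
    linear_combination this

end Interpolation

/-! ### Commensurate eigenvalues -/

section Commensurate

open Polynomial Filter Topology

/-- The largest point of `(2 ℤ + σ) π / t` not exceeding `x + σ π / t`. -/
noncomputable def latticeApprox (σ t x : ℝ) : ℝ := (2 * ⌊t * x / (2 * Real.pi)⌋ + σ) * Real.pi / t

lemma tendsto_latticeApprox (σ x : ℝ) :
    Tendsto (fun t => latticeApprox σ t x) atTop (𝓝 x) := by
  have hb : ∀ c : ℝ, Tendsto (fun t : ℝ => x + c / t) atTop (𝓝 x) := fun c => by
    simpa using (tendsto_const_nhds (x := x)).add (tendsto_const_nhds.div_atTop tendsto_id)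
  refine tendsto_of_tendsto_of_tendsto_of_le_of_le' (hb ((σ - 2) * Real.pi)) (hb (σ * Real.pi))
    ?_ ?_
  all_goals
    filter_upwards [eventually_gt_atTop 0] with t ht
    have h1 := Int.floor_le (t * x / (2 * Real.pi))
    have h2 := Int.lt_floor_add_one (t * x / (2 * Real.pi))
    have e : t * x / (2 * Real.pi) * (2 * Real.pi) = t * x := by field_simp
    have hpi := Real.pi_pos
    unfold latticeApprox
    generalize (⌊t * x / (2 * Real.pi)⌋ : ℝ) = k at h1 h2
    generalize t * x / (2 * Real.pi) = r at *
  · rw [show x + (σ - 2) * Real.pi / t = (t * x + (σ - 2) * Real.pi) / t by field_simp]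
    gcongr
    nlinarith
  · rw [show x + σ * Real.pi / t = (t * x + σ * Real.pi) / t by field_simp]
    gcongr
    nlinarith

lemma exp_latticeApprox_zero {t : ℝ} (ht : 0 < t) (x : ℝ) :
    Complex.exp (-(Complex.I * t) * (latticeApprox 0 t x : ℝ)) = 1 := by
  rw [Complex.exp_eq_one_iff]
  refine ⟨-⌊t * x / (2 * Real.pi)⌋, ?_⟩
  have : (t : ℂ) ≠ 0 := by exact_mod_cast ht.ne'
  simp only [latticeApprox]
  push_cast
  field_simp
  ring

lemma exp_latticeApprox_one {t : ℝ} (ht : 0 < t) (x : ℝ) :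
    Complex.exp (-(Complex.I * t) * (latticeApprox 1 t x : ℝ)) = -1 := by
  have h : Complex.exp (-(Complex.I * t) * (latticeApprox 1 t x : ℝ) + Real.pi * Complex.I)
      = 1 := by
    rw [Complex.exp_eq_one_iff]
    refine ⟨-⌊t * x / (2 * Real.pi)⌋, ?_⟩
    have : (t : ℂ) ≠ 0 := by exact_mod_cast ht.ne'
    simp only [latticeApprox]
    push_cast
    field_simp
    ring
  rw [Complex.exp_add, Complex.exp_pi_mul_I] at h
  linear_combination -h

lemma nodePoly_dvd {Y : Finset ℝ} {E : ℝ[X]} (hY : ∀ x ∈ Y, E.eval x = 0) : nodePoly Y ∣ E :=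
  Finset.prod_dvd_of_coprime
    (fun _ _ _ _ hxy => isCoprime_X_sub_C_of_isUnit_sub (sub_ne_zero.2 hxy).isUnit)
    fun x hx => dvd_iff_isRoot.2 (hY x hx)

/-- The secular polynomials of two disjointly supported measures have few zeros in common: a common
zero annihilates a nonzero polynomial that does not depend on the chain. -/
lemma card_common_roots_lt {Λp Λm : Finset ℝ} (hΛ : Λp.Nonempty) (hdisj : Disjoint Λp Λm)
    {ρp ρm : ℝ → ℝ} (hρp : ∀ l ∈ Λp, 0 < ρp l) {P Q : ℝ[X]} (hPQ : IsCoprime P Q)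
    {S : Finset ℝ} (hp : ∀ x ∈ S, (secularPoly (nodePoly Λp) (stieltjesNum Λp ρp) P Q).eval x = 0)
    (hm : ∀ x ∈ S, (secularPoly (nodePoly Λm) (stieltjesNum Λm ρm) P Q).eval x = 0) :
    S.card < Λp.card + Λm.card := by
  set W : ℝ[X] := nodePoly Λp * stieltjesNum Λm ρm - nodePoly Λm * stieltjesNum Λp ρp with hW
  have hW0 : W ≠ 0 := by
    intro h
    obtain ⟨x, hx⟩ := hΛ
    have := congrArg (eval x) h
    rw [hW, eval_sub, eval_mul, eval_mul, (nodePoly_eval_eq_zero_iff _ _).2 hx, zero_mul, eval_zero,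
      zero_sub, neg_eq_zero, mul_eq_zero, nodePoly_eval_eq_zero_iff] at this
    exact this.elim (Finset.disjoint_left.1 hdisj hx) (stieltjesNum_eval_ne_zero hρp hx)
  have hdeg : W.degree < (Λp.card + Λm.card : ℕ) := by
    have key : ∀ (A B : Finset ℝ) (ρ : ℝ → ℝ),
        (nodePoly A * stieltjesNum B ρ).degree < (A.card + B.card : ℕ) := by
      intro A B ρ
      rw [degree_mul, degree_eq_natDegree (nodePoly_monic A).ne_zero, nodePoly_natDegree,
        Nat.cast_add]
      exact WithBot.add_lt_add_left (WithBot.natCast_ne_bot _) (stieltjesNum_degree_lt B ρ)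
    refine (degree_sub_le _ _).trans_lt (max_lt (key _ _ _) ?_)
    rw [add_comm]
    exact key _ _ _
  refine lt_of_le_of_lt ?_ ((natDegree_lt_iff_degree_lt hW0).2 hdeg)
  refine card_le_degree_of_subset_roots fun x hx => (mem_roots hW0).2 ?_
  have h1 := hp x hx
  have h2 := hm x hx
  obtain ⟨u, v, huv⟩ := hPQ
  have h3 := congrArg (eval x) huv
  simp only [secularPoly, eval_sub, eval_mul, eval_add, eval_one] at h1 h2 h3
  rw [IsRoot.def, hW]
  simp only [eval_sub, eval_mul]
  linear_combination
    (-(eval x (nodePoly Λp) * eval x (stieltjesNum Λm ρm)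
      - eval x (nodePoly Λm) * eval x (stieltjesNum Λp ρp))) * h3
    + (u.eval x * (stieltjesNum Λm ρm).eval x + v.eval x * (nodePoly Λm).eval x) * h1
    - (u.eval x * (stieltjesNum Λp ρp).eval x + v.eval x * (nodePoly Λp).eval x) * h2

/-- There is a chain for which all zeros of the two secular polynomials, apart from a number of them
that is smaller than the length `m + 1` of the chain, are even multiples of `π / t` in one case
and odd multiples in the other. -/
theorem exists_commensurate_chain {Λp Λm : Finset ℝ} (hΛ : Λp.Nonempty) (hdisj : Disjoint Λp Λm)
    {ρp ρm : ℝ → ℝ} (hρp : ∀ l ∈ Λp, 0 < ρp l) (hρm : ∀ l ∈ Λm, 0 < ρm l) :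
    ∃ (m : ℕ) (α w : ℕ → ℝ) (t : ℝ) (Yp Ym : Finset ℝ) (Fp Fm : ℝ[X]),
      (∀ k, 0 < w k) ∧ 0 < t ∧
      secularPoly (nodePoly Λp) (stieltjesNum Λp ρp) (orthPoly α w (m + 1))
        (C (w m) * orthPoly α w m) = nodePoly Yp * Fp ∧
      secularPoly (nodePoly Λm) (stieltjesNum Λm ρm) (orthPoly α w (m + 1))
        (C (w m) * orthPoly α w m) = nodePoly Ym * Fm ∧
      Fp * Fm ≠ 0 ∧ (Fp * Fm).natDegree ≤ m ∧
      (∀ y ∈ Yp, Complex.exp (-(Complex.I * t) * (y : ℝ)) = 1) ∧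
      (∀ y ∈ Ym, Complex.exp (-(Complex.I * t) * (y : ℝ)) = -1) := by
  classical
  set m := Λp.card + Λm.card with hmdef
  -- An arbitrary chain of length `m + 1` to start from.
  set α₀ : ℕ → ℝ := fun _ => 0
  set w₀ : ℕ → ℝ := fun _ => 1
  have hw₀ : ∀ k, 0 < w₀ k := fun _ => one_pos
  set P := orthPoly α₀ w₀ (m + 1) with hP
  set Q := C (w₀ m) * orthPoly α₀ w₀ m with hQ
  have hPm : P.Monic := orthPoly_monic _ _ _
  have hPd : P.natDegree = m + 1 := orthPoly_natDegree _ _ _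
  have hQd : Q.natDegree ≤ m := (natDegree_C_mul_le _ _).trans (orthPoly_natDegree _ _ _).le
  have hPQ : IsCoprime P Q :=
    (isCoprime_mul_unit_left_right (isUnit_C.2 (hw₀ m).ne'.isUnit) _ _).2 (orthPoly_isCoprime hw₀ m)
  set Dp := nodePoly Λp with hDp
  set Dm := nodePoly Λm with hDm
  set Np := stieltjesNum Λp ρp with hNp
  set Nm := stieltjesNum Λm ρm with hNm
  set Xp := (secularPoly Dp Np P Q).roots.toFinset with hXp
  set Xm := (secularPoly Dm Nm P Q).roots.toFinset with hXm
  have hXpc : Xp.card = m + 1 + Λp.card := card_roots_secularPoly hw₀ m hρp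
  have hXmc : Xm.card = m + 1 + Λm.card := card_roots_secularPoly hw₀ m hρm
  have hXp0 : ∀ x ∈ Xp, (secularPoly Dp Np P Q).eval x = 0 := fun x hx => by
    rw [hXp, Multiset.mem_toFinset] at hx; exact isRoot_of_mem_roots hx
  have hXm0 : ∀ x ∈ Xm, (secularPoly Dm Nm P Q).eval x = 0 := fun x hx => by
    rw [hXm, Multiset.mem_toFinset] at hx; exact isRoot_of_mem_roots hx
  have hcommon : (Xp ∩ Xm).card < Λp.card + Λm.card :=
    card_common_roots_lt (ρm := ρm) hΛ hdisj hρp hPQ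
      (fun x hx => hXp0 x (Finset.mem_of_mem_inter_left hx))
      (fun x hx => hXm0 x (Finset.mem_of_mem_inter_right hx))
  -- Keep just enough zeros for the number of conditions to match the number of coefficients.
  -- The zeros common to both polynomials, which would give coinciding nodes, are left out.
  obtain ⟨Y, hYsub, hYc⟩ : ∃ Y ⊆ Xp \ Xm, Y.card = Λp.card + 1 := by
    refine Finset.exists_subset_card_eq ?_
    have := Finset.card_sdiff_add_card_inter Xp Xm
    lia
  set D : Y ⊕ Xm → ℝ[X] := Sum.elim (fun _ => Dp) (fun _ => Dm) with hD
  set N : Y ⊕ Xm → ℝ[X] := Sum.elim (fun _ => Np) (fun _ => Nm) with hN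
  set x : Y ⊕ Xm → ℝ := Sum.elim Subtype.val Subtype.val with hx
  set y : ℝ → Y ⊕ Xm → ℝ := fun t =>
    Sum.elim (fun j => latticeApprox 0 t j) (fun j => latticeApprox 1 t j) with hy
  have hxinj : Function.Injective x := by
    refine Function.Injective.sumElim Subtype.val_injective Subtype.val_injective ?_
    rintro ⟨a, ha⟩ ⟨b, hb⟩ rfl
    exact (Finset.mem_sdiff.1 (hYsub ha)).2 hb
  have hcard : Fintype.card (Y ⊕ Xm) = 2 * (m + 1) := by
    rw [Fintype.card_sum, Fintype.card_coe, Fintype.card_coe, hYc, hXmc]; lia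
  have hytend : Tendsto y atTop (𝓝 x) := by
    refine tendsto_pi_nhds.2 ?_
    rintro (j | j)
    · exact tendsto_latticeApprox 0 j
    · exact tendsto_latticeApprox 1 j
  have hDN : ∀ (Λ : Finset ℝ) (ρ : ℝ → ℝ), (∀ l ∈ Λ, 0 < ρ l) → ∀ z,
      (nodePoly Λ).eval z ≠ 0 ∨ (stieltjesNum Λ ρ).eval z ≠ 0 := fun Λ ρ hρ z => by
    by_cases h : z ∈ Λ
    · exact Or.inr (stieltjesNum_eval_ne_zero hρ h)
    · exact Or.inl fun h' => h ((nodePoly_eval_eq_zero_iff Λ z).1 h')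
  obtain ⟨P', Q', hP', hQ', hPc, hQc, hzero⟩ := exists_interpolation (D := D) (N := N) hcard hxinj
    hPm hPd hQd hPQ
    (by
      rintro (j | j)
      · have := hXp0 j (Finset.mem_sdiff.1 (hYsub j.2)).1
        rwa [secularPoly, eval_sub, eval_mul, eval_mul, sub_eq_zero] at this
      · have := hXm0 j j.2
        rwa [secularPoly, eval_sub, eval_mul, eval_mul, sub_eq_zero] at this)
    (by
      rintro (j | j)
      · exact hDN _ _ hρp _
      · exact hDN _ _ hρm _)
    hytend
  have hchain := eventually_exists_orthPoly m α₀ w₀ hw₀ P' Q' (Eventually.of_forall hP')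
    (Eventually.of_forall hQ') hPc hQc
  have hinj : ∀ᶠ t in atTop, ∀ i j, i ≠ j → y t i ≠ y t j := by
    refine eventually_all.2 fun i => eventually_all.2 fun j => ?_
    by_cases hij : i = j
    · exact Eventually.of_forall fun t h => absurd hij h
    · have h1 := ((tendsto_pi_nhds.1 hytend i).sub (tendsto_pi_nhds.1 hytend j)).eventually_ne
        (sub_ne_zero.2 (hxinj.ne hij))
      filter_upwards [h1] with t ht _ using sub_ne_zero.1 ht
  obtain ⟨t, ⟨α, w, hw, eP, eQ⟩, hz, hi, ht⟩ :=
    (hchain.and (hzero.and (hinj.and (eventually_gt_atTop 0)))).exists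
  have hyinj : Function.Injective (y t) := fun i j hij => by
    by_contra hne
    exact hi i j hne hij
  set Yp : Finset ℝ := Finset.univ.image fun j : Y => y t (Sum.inl j) with hYp
  set Ym : Finset ℝ := Finset.univ.image fun j : Xm => y t (Sum.inr j) with hYm
  have hYpc : Yp.card = Λp.card + 1 := by
    rw [hYp, Finset.card_image_of_injective _ fun i j hij => Sum.inl_injective (hyinj hij),
      Finset.card_univ,
      Fintype.card_coe, hYc]
  have hYmc : Ym.card = m + 1 + Λm.card := by
    rw [hYm, Finset.card_image_of_injective _ fun i j hij => Sum.inr_injective (hyinj hij),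
      Finset.card_univ,
      Fintype.card_coe, hXmc]
  have hdvdp : nodePoly Yp ∣ secularPoly Dp Np (P' t) (Q' t) := nodePoly_dvd fun z hz' => by
    obtain ⟨j, -, rfl⟩ := Finset.mem_image.1 hz'
    exact hz (Sum.inl j)
  have hdvdm : nodePoly Ym ∣ secularPoly Dm Nm (P' t) (Q' t) := nodePoly_dvd fun z hz' => by
    obtain ⟨j, -, rfl⟩ := Finset.mem_image.1 hz'
    exact hz (Sum.inr j)
  obtain ⟨Fp, hFp⟩ := hdvdp
  obtain ⟨Fm, hFm⟩ := hdvdm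
  have hlt : ∀ (Λ : Finset ℝ) (ρ : ℝ → ℝ), (stieltjesNum Λ ρ).degree < (nodePoly Λ).degree :=
    fun Λ ρ => by
      rw [degree_eq_natDegree (nodePoly_monic Λ).ne_zero, nodePoly_natDegree]
      exact stieltjesNum_degree_lt Λ ρ
  obtain ⟨hEp, hEpd⟩ := secularPoly_monic_natDegree (nodePoly_monic Λp) (hlt Λp ρp) (hP' t).1
    (hP' t).2 (hQ' t)
  obtain ⟨hEm, hEmd⟩ := secularPoly_monic_natDegree (nodePoly_monic Λm) (hlt Λm ρm) (hP' t).1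
    (hP' t).2 (hQ' t)
  have hFpm : Fp.Monic := (nodePoly_monic Yp).of_mul_monic_left (hFp ▸ hEp)
  have hFmm : Fm.Monic := (nodePoly_monic Ym).of_mul_monic_left (hFm ▸ hEm)
  rw [← hDp, ← hNp, hFp, (nodePoly_monic Yp).natDegree_mul hFpm, nodePoly_natDegree, hDp,
    nodePoly_natDegree, hYpc] at hEpd
  rw [← hDm, ← hNm, hFm, (nodePoly_monic Ym).natDegree_mul hFmm, nodePoly_natDegree, hDm,
    nodePoly_natDegree, hYmc] at hEmd
  refine ⟨m, α, w, t, Yp, Ym, Fp, Fm, hw, ht, ?_, ?_, (hFpm.mul hFmm).ne_zero, ?_, ?_, ?_⟩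
  · rw [← eP, ← eQ, hFp]
  · rw [← eP, ← eQ, hFm]
  · rw [hFpm.natDegree_mul hFmm]; lia
  · intro z hz'
    obtain ⟨j, -, rfl⟩ := Finset.mem_image.1 hz'
    exact exp_latticeApprox_zero ht _
  · intro z hz'
    obtain ⟨j, -, rfl⟩ := Finset.mem_image.1 hz'
    exact exp_latticeApprox_one ht _

end Commensurate

/-! ### Polynomials of an operator along a chain -/

section Operator

open Polynomial

variable {V : Type*} [AddCommGroup V] [Module ℝ V]

/-- The product of the first `k` couplings `√w j` of a chain. -/
noncomputable def couplingProd (w : ℕ → ℝ) (k : ℕ) : ℝ := ∏ j ∈ Finset.range k, √(w j)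

lemma couplingProd_succ (w : ℕ → ℝ) (k : ℕ) :
    couplingProd w (k + 1) = couplingProd w k * √(w k) :=
  Finset.prod_range_succ _ _

lemma couplingProd_pos {w : ℕ → ℝ} (hw : ∀ k, 0 < w k) (k : ℕ) : 0 < couplingProd w k :=
  Finset.prod_pos fun j _ => Real.sqrt_pos.2 (hw j)

/-- The orthogonal polynomials of an operator that acts as a chain on `e 0, …, e m` move the first
vector along the chain. -/
lemma aeval_orthPoly_chain {α w : ℕ → ℝ} (hw : ∀ k, 0 < w k) {m : ℕ} {T : Module.End ℝ V}
    {e : ℕ → V} (h0 : T (e 0) = √(w 0) • e 1 + α 0 • e 0)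
    (hT : ∀ k, k + 1 ≤ m → T (e (k + 1)) = √(w (k + 1)) • e (k + 2) + α (k + 1) • e (k + 1)
      + √(w k) • e k) {k : ℕ} (hk : k ≤ m + 1) :
    aeval T (orthPoly α w k) (e 0) = couplingProd w k • e k := by
  induction k using Nat.strong_induction_on with
  | _ k ih =>
    match k with
    | 0 => simp [orthPoly, couplingProd]
    | 1 => simp [orthPoly, couplingProd, h0, Module.algebraMap_end_apply]
    | k + 2 =>
      rw [orthPoly_add_two, map_sub, map_mul, map_mul, LinearMap.sub_apply, Module.End.mul_apply,
        Module.End.mul_apply, ih (k + 1) (by lia) (by lia), ih k (by lia) (by lia), map_sub,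
        aeval_X, aeval_C, aeval_C, LinearMap.sub_apply, map_smul, hT k (by lia),
        Module.algebraMap_end_apply, Module.algebraMap_end_apply, couplingProd_succ w (k + 1),
        couplingProd_succ w k]
      have hs : √(w k) * √(w k) = w k := Real.mul_self_sqrt (hw k).le
      have hs' : w k • (couplingProd w k • e k)
          = (couplingProd w k * √(w k)) • (√(w k) • e k) := by
        rw [smul_smul, smul_smul, mul_assoc, hs, mul_comm]
      rw [hs']
      module

/-- If the last vector of the chain is coupled to a system, in which the contact vector
`e (m + 1)` has the spectral measure `∑ ρ l δ_l`, then the secular polynomial annihilates `e 0`. -/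
lemma aeval_secularPoly_eq_zero {α w : ℕ → ℝ} (hw : ∀ k, 0 < w k) {m : ℕ} {T : Module.End ℝ V}
    {e : ℕ → V} (h0 : T (e 0) = √(w 0) • e 1 + α 0 • e 0)
    (hT : ∀ k, k + 1 ≤ m → T (e (k + 1)) = √(w (k + 1)) • e (k + 2) + α (k + 1) • e (k + 1)
      + √(w k) • e k) {Λ : Finset ℝ} {ρ : ℝ → ℝ} {v : ℝ → V}
    (hv : ∀ l ∈ Λ, T (v l) = l • v l + (√(w m) * ρ l) • e m) (hsum : ∑ l ∈ Λ, v l = e (m + 1)) :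
    aeval T (secularPoly (nodePoly Λ) (stieltjesNum Λ ρ) (orthPoly α w (m + 1))
      (C (w m) * orthPoly α w m)) (e 0) = 0 := by
  have hD : aeval T (nodePoly Λ) (e (m + 1)) = √(w m) • aeval T (stieltjesNum Λ ρ) (e m) := by
    rw [← hsum, map_sum, stieltjesNum, map_sum, LinearMap.sum_apply, Finset.smul_sum]
    refine Finset.sum_congr rfl fun l hl => ?_
    rw [nodePoly_eq_mul_erase hl, mul_comm, map_mul, map_mul, Module.End.mul_apply,
      Module.End.mul_apply, map_sub, aeval_X, aeval_C, LinearMap.sub_apply, hv l hl, aeval_C,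
      Module.algebraMap_end_apply, Module.algebraMap_end_apply, add_sub_cancel_left, map_smul,
      smul_smul]
  have hs : √(w m) * √(w m) = w m := Real.mul_self_sqrt (hw m).le
  rw [secularPoly, map_sub, LinearMap.sub_apply, sub_eq_zero, mul_comm, map_mul,
    Module.End.mul_apply, aeval_orthPoly_chain hw h0 hT le_rfl, map_smul, hD,
    mul_comm (C (w m) * _), map_mul, Module.End.mul_apply, map_mul, Module.End.mul_apply,
    aeval_orthPoly_chain hw h0 hT (Nat.le_succ m), aeval_C, Module.algebraMap_end_apply, map_smul,
    map_smul, smul_smul, smul_smul, couplingProd_succ, mul_assoc, hs, mul_comm]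

lemma exists_eq_sum_orthPoly (α w : ℕ → ℝ) {d : ℕ} {f : ℝ[X]} (hf : f.natDegree ≤ d) :
    ∃ c : ℕ → ℝ, f = ∑ k ∈ Finset.range (d + 1), C (c k) * orthPoly α w k ∧ c d = f.coeff d := by
  induction d generalizing f with
  | zero =>
    refine ⟨fun _ => f.coeff 0, ?_, rfl⟩
    simpa [orthPoly] using eq_C_of_natDegree_le_zero hf
  | succ d ih =>
    have hlead : (orthPoly α w (d + 1)).coeff (d + 1) = 1 := by
      have := orthPoly_monic α w (d + 1)
      rwa [Monic, leadingCoeff, orthPoly_natDegree] at this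
    obtain ⟨c, hc, -⟩ := ih (f := f - C (f.coeff (d + 1)) * orthPoly α w (d + 1)) (by
      rw [natDegree_le_iff_coeff_eq_zero]
      intro N hN
      rw [coeff_sub, coeff_C_mul]
      rcases (by lia : N = d + 1 ∨ d + 1 < N) with rfl | h
      · rw [hlead, mul_one, sub_self]
      · rw [coeff_eq_zero_of_natDegree_lt (p := f) (hf.trans_lt h),
          coeff_eq_zero_of_natDegree_lt (p := orthPoly α w (d + 1))
            (by rwa [orthPoly_natDegree]), mul_zero, sub_zero])
    refine ⟨Function.update c (d + 1) (f.coeff (d + 1)), ?_, Function.update_self ..⟩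
    rw [Finset.sum_range_succ, Function.update_self, ← sub_eq_iff_eq_add, hc]
    refine Finset.sum_congr rfl fun k hk => ?_
    rw [Function.update_of_ne (Finset.mem_range.1 hk).ne]

/-- A vector annihilated by `∏ (T - y)`, over distinct `y`, is a sum of eigenvectors. -/
lemma exists_sum_eigenvectors {T : Module.End ℝ V} {Y : Finset ℝ} {v : V}
    (hv : aeval T (nodePoly Y) v = 0) :
    ∃ u : ℝ → V, v = ∑ y ∈ Y, u y ∧ ∀ y ∈ Y, T (u y) = y • u y := by
  induction Y using Finset.induction_on generalizing v with
  | empty => exact ⟨0, by simpa [nodePoly] using hv, by simp⟩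
  | insert y Y hy ih =>
    set z := aeval T (nodePoly Y) v with hz
    have hTz : T z = y • z := by
      rw [nodePoly_eq_mul_erase (Finset.mem_insert_self y Y), Finset.erase_insert hy, map_mul,
        Module.End.mul_apply, ← hz, map_sub, aeval_X, aeval_C, LinearMap.sub_apply,
        Module.algebraMap_end_apply] at hv
      exact sub_eq_zero.1 hv
    have hne : (nodePoly Y).eval y ≠ 0 := fun h => hy ((nodePoly_eval_eq_zero_iff Y y).1 h)
    obtain ⟨u, hu, hTu⟩ := ih (v := v - ((nodePoly Y).eval y)⁻¹ • z) (by
      rw [map_sub, ← hz, map_smul, Module.End.aeval_apply_of_mem_apply_eq_smul hTz, smul_smul,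
        inv_mul_cancel₀ hne, one_smul, sub_self])
    refine ⟨Function.update u y (((nodePoly Y).eval y)⁻¹ • z), ?_, ?_⟩
    · rw [Finset.sum_insert hy, Function.update_self, ← sub_eq_iff_eq_add', hu]
      refine Finset.sum_congr rfl fun x hx => ?_
      rw [Function.update_of_ne (ne_of_mem_of_not_mem hx hy)]
    · intro x hx
      by_cases hxy : x = y
      · rw [hxy, Function.update_self, map_smul, hTz, smul_comm]
      · rw [Function.update_of_ne hxy]
        exact hTu x (Finset.mem_of_mem_insert_of_ne hx hxy)

end Operator

/-! ### Spectral facts about matrices -/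

section Matrix

lemma exp_smul_mulVec_of_eigenvector {n : Type*} [Fintype n] [DecidableEq n] {M : Matrix n n ℂ}
    {v : n → ℂ} {l : ℂ} (h : M.mulVec v = l • v) (c : ℂ) :
    (NormedSpace.exp (c • M)).mulVec v = Complex.exp (c * l) • v := by
  -- Matrices carry no global norm; any norm that induces the product topology will do.
  let _ : NormedRing (Matrix n n ℂ) := Matrix.linftyOpNormedRing
  let _ : NormedAlgebra ℂ (Matrix n n ℂ) := Matrix.linftyOpNormedAlgebra
  have hpow : ∀ k : ℕ, ((c • M) ^ k).mulVec v = (c * l) ^ k • v := by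
    intro k
    induction k with
    | zero => simp
    | succ k ih =>
      rw [pow_succ, ← Matrix.mulVec_mulVec, Matrix.smul_mulVec, h, smul_smul, Matrix.mulVec_smul,
        ih, smul_smul, pow_succ']
  let L : Matrix n n ℂ →ₗ[ℂ] (n → ℂ) :=
    { toFun := fun A => A.mulVec v
      map_add' := fun A B => Matrix.add_mulVec A B v
      map_smul' := fun r A => Matrix.smul_mulVec r A v }
  have hL : Continuous L := LinearMap.continuous_of_finiteDimensional L
  have h1 := (NormedSpace.exp_series_hasSum_exp' (𝕂 := ℂ) (c • M)).map L hL
  have h2 := (NormedSpace.exp_series_hasSum_exp' (𝕂 := ℂ) (c * l)).smul_const v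
  rw [← Complex.exp_eq_exp_ℂ] at h2
  refine h1.unique ?_
  convert h2 using 2 with k
  simp only [Function.comp, L, LinearMap.coe_mk, AddHom.coe_mk]
  rw [Matrix.smul_mulVec, hpow, smul_smul, smul_eq_mul]

/-- The spectral measure of a Hermitian matrix at a basis vector, with the components of that
vector in the eigenspaces. -/
lemma exists_spectral_resolution {n : Type*} [Fintype n] [DecidableEq n] {M : Matrix n n ℂ}
    (hM : M.IsHermitian) (i : n) :
    ∃ (Λ : Finset ℝ) (ρ : ℝ → ℝ) (v : ℝ → n → ℂ), (∀ l ∈ Λ, 0 < ρ l) ∧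
      (∀ l, M.mulVec (v l) = (l : ℂ) • v l) ∧ (∀ l, v l i = ρ l) ∧
      ∑ l ∈ Λ, v l = Pi.single i 1 := by
  classical
  set u := hM.eigenvectorBasis with hu
  set S := Finset.univ.image hM.eigenvalues with hS
  set v : ℝ → n → ℂ := fun l =>
    ∑ j with hM.eigenvalues j = l, (starRingEnd ℂ) (u j i) • (u j : n → ℂ) with hv
  set ρ : ℝ → ℝ := fun l => ∑ j with hM.eigenvalues j = l, Complex.normSq (u j i) with hρ
  have hvi : ∀ l, v l i = ρ l := by
    intro l
    simp only [hv, hρ, Finset.sum_apply, Pi.smul_apply, smul_eq_mul, Complex.ofReal_sum,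
      Complex.normSq_eq_conj_mul_self]
  have hρ0 : ∀ l, 0 ≤ ρ l := fun l => Finset.sum_nonneg fun j _ => Complex.normSq_nonneg _
  have hv0 : ∀ l, ρ l = 0 → v l = 0 := by
    intro l hl
    rw [hρ, Finset.sum_eq_zero_iff_of_nonneg fun j _ => Complex.normSq_nonneg _] at hl
    exact Finset.sum_eq_zero fun j hj => by rw [Complex.normSq_eq_zero.1 (hl j hj)]; simp
  refine ⟨S.filter fun l => ρ l ≠ 0, ρ, v,
    fun l hl => (hρ0 l).lt_of_ne' (Finset.mem_filter.1 hl).2, fun l => ?_, hvi, ?_⟩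
  · simp only [hv]
    rw [Matrix.mulVec_sum, Finset.smul_sum]
    refine Finset.sum_congr rfl fun j hj => ?_
    rw [Matrix.mulVec_smul, hM.mulVec_eigenvectorBasis, (Finset.mem_filter.1 hj).2, smul_comm]
    rfl
  · have hfilter : ∑ l ∈ S with ρ l ≠ 0, v l = ∑ l ∈ S, v l :=
      Finset.sum_filter_of_ne fun l _ h h' => h (hv0 l h')
    rw [hfilter]
    have h1 : ∑ l ∈ S, v l = ∑ j, (starRingEnd ℂ) (u j i) • (u j : n → ℂ) :=
      Finset.sum_fiberwise_of_maps_to (fun j _ => Finset.mem_image_of_mem _ (Finset.mem_univ j)) _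
    rw [h1]
    have h2 := u.sum_repr (EuclideanSpace.single i (1 : ℂ))
    have h3 := congrArg (fun x : EuclideanSpace ℂ n => (x : n → ℂ)) h2
    simp only [OrthonormalBasis.repr_apply_apply, EuclideanSpace.inner_single_right, one_mul] at h3
    funext k
    have h4 := congrFun h3 k
    simpa [Finset.sum_apply, Pi.single_apply] using h4

end Matrix

/-! ### Reduction of the extended system by its mirror symmetry -/

section Reduction

open scoped Polynomial
open Polynomial (aeval aeval_C)

/-- The `(m + 1) × (m + 1)` tridiagonal matrix with diagonal `α` and couplings `√w`. Its index `0`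
is the end of the chain that is not coupled to the given system. -/
noncomputable def chainMatrix (m : ℕ) (α w : ℕ → ℝ) : Matrix (Fin (m + 1)) (Fin (m + 1)) ℝ :=
  Matrix.of fun i j =>
    if i.val = j.val then α i else if i.val + 1 = j.val then √(w i)
    else if j.val + 1 = i.val then √(w j) else 0

lemma isTridiagonalChain_chainMatrix (m : ℕ) (α : ℕ → ℝ) {w : ℕ → ℝ} (hw : ∀ k, 0 < w k) :
    IsTridiagonalChain ((chainMatrix m α w).submatrix Fin.rev Fin.rev) := by
  refine ⟨?_, fun i j hij => ?_, fun i j hij => ?_⟩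
  · ext i j
    simp only [Matrix.transpose_apply, Matrix.submatrix_apply, chainMatrix, Matrix.of_apply]
    split_ifs <;> first | rfl | lia
  · simp only [Matrix.submatrix_apply, chainMatrix, Matrix.of_apply, Fin.val_rev]
    rw [if_neg (by lia), if_neg (by lia), if_neg (by lia)]
  · simp only [Matrix.submatrix_apply, chainMatrix, Matrix.of_apply, Fin.val_rev]
    rw [if_neg (by lia), if_neg (by lia), if_pos (by lia)]
    exact Real.sqrt_pos.2 (hw _)

lemma link_mulVec (m n : ℕ) (c : ℝ) (x : Fin (n + 1) → ℂ) :
    (link (m + 1) (n + 1) c).mulVec x = Pi.single (Fin.last m) (c * x 0) := by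
  ext i
  rw [Matrix.mulVec, dotProduct, Finset.sum_eq_single 0]
  · by_cases h : i = Fin.last m
    · subst h; simp [link]
    · rw [Pi.single_eq_of_ne h]
      have : i.val ≠ m := fun h' => h (Fin.ext h')
      simp [link, this]
  · intro j _ hj
    simp [link, hj]
  · simp

lemma link_transpose_mulVec (m n : ℕ) (c : ℝ) (x : Fin (m + 1) → ℂ) :
    (link (m + 1) (n + 1) c).transpose.mulVec x = Pi.single 0 (c * x (Fin.last m)) := by
  ext i
  rw [Matrix.mulVec, dotProduct, Finset.sum_eq_single (Fin.last m)]
  · by_cases h : i = 0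
    · subst h; simp [link]
    · rw [Pi.single_eq_of_ne h]
      simp [link, h]
  · intro j _ hj
    have : j.val ≠ m := fun h' => hj (Fin.ext h')
    simp [link, this]
  · simp

lemma outProj_mulVec (n : ℕ) (x : Fin (n + 1) → ℂ) :
    (outProj (n + 1)).mulVec x = Pi.single (Fin.last n) (x (Fin.last n)) := by
  ext i
  rw [outProj, Matrix.mulVec_diagonal]
  by_cases h : i = Fin.last n
  · subst h; simp
  · have : i.val ≠ n := fun h' => h (Fin.ext h')
    simp [this, h]

lemma mirror_mirror {a b : ℕ} (s : Site a b) : mirror (mirror s) = s := by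
  rcases s with (i | i) | (i | i) <;> simp [mirror]

lemma link_rev_rev (m n : ℕ) (c : ℝ) (i : Fin m) (j : Fin n) :
    link n m c j.rev i.rev = link m n c i j := by
  simp only [link, Matrix.of_apply, Fin.val_rev]
  congr 1
  exact propext ⟨fun h => by lia, fun h => by lia⟩

lemma extendedH_mirror {a b : ℕ} (A : Matrix (Fin a) (Fin a) ℝ) (B : Matrix (Fin b) (Fin b) ℂ)
    (J J' : ℝ) (s s' : Site a b) :
    extendedH A B J J' (mirror s) (mirror s') = extendedH A B J J' s s' := by
  rcases s with (i | i) | (i | i) <;> rcases s' with (j | j) | (j | j) <;>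
    simp [mirror, extendedH, reversed, link_rev_rev]

/-- The vector on the whole system whose first half, consisting of the mirrored chain and the given
system, is `x`, and whose second half is `σ` times the mirror image of `x`. For `σ = ± 1` these are
the vectors of parity `σ` under `mirror`. -/
def withParity {a b : ℕ} (σ : ℝ) (x : Fin a ⊕ Fin b → ℂ) : Site a b → ℂ :=
  Sum.elim x fun r => σ * Sum.elim (fun i : Fin b => x (Sum.inr i.rev))
    (fun i : Fin a => x (Sum.inl i.rev)) r

lemma withParity_mirror {a b : ℕ} {σ : ℝ} (hσ : σ * σ = 1) (x : Fin a ⊕ Fin b → ℂ)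
    (s : Site a b) : withParity σ x (mirror s) = σ * withParity σ x s := by
  have h : (σ : ℂ) * σ = 1 := by exact_mod_cast hσ
  rcases s with (i | i) | (i | i) <;> simp [mirror, withParity, ← mul_assoc, h]

/-- The matrix of the chain, in reversed order, attached to the first vertex of a system with
matrix `C`. With `C = C_±` it is the restriction of `extendedH` to vectors of parity `± 1`. -/
def halfH {a b : ℕ} (A : Matrix (Fin a) (Fin a) ℝ) (C : Matrix (Fin b) (Fin b) ℂ) (J : ℝ) :
    Matrix (Fin a ⊕ Fin b) (Fin a ⊕ Fin b) ℂ :=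
  Matrix.fromBlocks (reversed (A.map Complex.ofReal)) (link a b J) (link a b J).transpose C

/-- In a vector of parity `σ` the link between the two copies of the given system turns into the
term `σ J'` on its output vertex. -/
lemma extendedH_mulVec_withParity {m n : ℕ} (A : Matrix (Fin (m + 1)) (Fin (m + 1)) ℝ)
    (B : Matrix (Fin (n + 1)) (Fin (n + 1)) ℂ) (J J' : ℝ) {σ : ℝ} (hσ : σ * σ = 1)
    (x : Fin (m + 1) ⊕ Fin (n + 1) → ℂ) :
    (extendedH A B J J').mulVec (withParity σ x)
      = withParity σ ((halfH A (B + ((σ * J' : ℝ) : ℂ) • outProj (n + 1)) J).mulVec x) := by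
  have hleft : ∀ s, (extendedH A B J J').mulVec (withParity σ x) (Sum.inl s)
      = withParity σ ((halfH A (B + ((σ * J' : ℝ) : ℂ) • outProj (n + 1)) J).mulVec x)
        (Sum.inl s) := by
    intro s
    rw [extendedH, Matrix.fromBlocks_mulVec]
    have h1 : withParity σ x ∘ Sum.inl = x := rfl
    rw [h1, Sum.elim_inl, withParity, withParity, Sum.elim_inl, Pi.add_apply, halfH,
      Matrix.fromBlocks_mulVec, Matrix.fromBlocks_mulVec, Matrix.fromBlocks_mulVec, link_mulVec n n,
      Matrix.add_mulVec, Matrix.smul_mulVec, outProj_mulVec]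
    rcases s with i | i
    · simp
    · by_cases h : i = Fin.last n
      · subst h; simp [Fin.rev_zero]; ring
      · simp [h]
  ext s
  rcases s with s | s
  · exact hleft s
  · obtain ⟨r, hr⟩ : ∃ r, mirror (Sum.inl r) = (Sum.inr s : Site (m + 1) (n + 1)) := by
      rcases s with i | i
      · exact ⟨Sum.inr i.rev, by simp [mirror]⟩
      · exact ⟨Sum.inl i.rev, by simp [mirror]⟩
    have hsum : ∀ g : Site (m + 1) (n + 1) → ℂ, ∑ s', g s' = ∑ s', g (mirror s') := fun g =>
      (Equiv.sum_comp (Function.Involutive.toPerm mirror mirror_mirror) g).symm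
    rw [← hr, withParity_mirror hσ, ← hleft, Matrix.mulVec, dotProduct, hsum, Matrix.mulVec,
      dotProduct, Finset.mul_sum]
    refine Finset.sum_congr rfl fun s' _ => ?_
    rw [extendedH_mirror, withParity_mirror hσ]
    ring

/-! ### The chain attached to a system -/

/-- The basis vectors along the chain, from its free end; the vector with index `m + 1` is the one
of the input vertex of the given system. -/
def siteVec (m n k : ℕ) : Fin (m + 1) ⊕ Fin (n + 1) → ℂ :=
  Sum.elim (fun i => if i.val = k then 1 else 0)
    (fun j => if k = m + 1 ∧ j.val = 0 then 1 else 0)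

/-- `halfH`, for the chain with coefficients `α`, `w` coupled with strength `√(w m)`, as a
real-linear map: all polynomials evaluated at it have real coefficients. -/
noncomputable def halfEnd {m n : ℕ} (α w : ℕ → ℝ) (C : Matrix (Fin (n + 1)) (Fin (n + 1)) ℂ) :
    Module.End ℝ (Fin (m + 1) ⊕ Fin (n + 1) → ℂ) :=
  ((halfH ((chainMatrix m α w).submatrix Fin.rev Fin.rev) C (√(w m))).mulVecLin).restrictScalars ℝ

lemma halfEnd_apply {m n : ℕ} (α w : ℕ → ℝ) (C : Matrix (Fin (n + 1)) (Fin (n + 1)) ℂ)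
    (x : Fin (m + 1) ⊕ Fin (n + 1) → ℂ) :
    halfEnd α w C x = Sum.elim
      (((chainMatrix m α w).map Complex.ofReal).mulVec (x ∘ Sum.inl)
        + Pi.single (Fin.last m) ((√(w m) : ℝ) * x (Sum.inr 0)))
      (Pi.single 0 ((√(w m) : ℝ) * x (Sum.inl (Fin.last m))) + C.mulVec (x ∘ Sum.inr)) := by
  have h : reversed (((chainMatrix m α w).submatrix Fin.rev Fin.rev).map Complex.ofReal)
      = (chainMatrix m α w).map Complex.ofReal := by
    ext i j; simp [reversed]
  rw [halfEnd, LinearMap.restrictScalars_apply, Matrix.mulVecLin_apply, halfH,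
    Matrix.fromBlocks_mulVec, link_mulVec, link_transpose_mulVec, h]
  rfl

lemma halfEnd_siteVec {m n : ℕ} (α w : ℕ → ℝ) (C : Matrix (Fin (n + 1)) (Fin (n + 1)) ℂ) {k : ℕ}
    (hk : k ≤ m) : halfEnd α w C (siteVec m n k) = √(w k) • siteVec m n (k + 1)
      + α k • siteVec m n k + (if k = 0 then 0 else √(w (k - 1)) • siteVec m n (k - 1)) := by
  have h1 : siteVec m n k ∘ Sum.inl = Pi.single ⟨k, by lia⟩ 1 := by
    ext i
    simp only [Function.comp_apply, siteVec, Sum.elim_inl, Pi.single_apply, Fin.ext_iff]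
  have h2 : siteVec m n k ∘ Sum.inr = 0 := by
    ext j
    have : k ≠ m + 1 := by lia
    simp [siteVec, this]
  rw [halfEnd_apply, h1, h2, Matrix.mulVec_single_one, Matrix.mulVec_zero]
  ext s
  rcases s with i | j
  · have hne : k ≠ m + 1 := by lia
    have hi := i.2
    simp only [siteVec, Sum.elim_inl, Sum.elim_inr, Pi.add_apply, Pi.smul_apply, Matrix.col_apply,
      Matrix.map_apply, chainMatrix, Matrix.of_apply, hne, false_and, if_false, mul_zero,
      Pi.single_zero, add_zero]
    by_cases hk0 : k = 0
    · subst hk0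
      simp only [if_true, Pi.zero_apply, add_zero, zero_add]
      rcases (by lia : i.val = 0 ∨ i.val = 1 ∨ 1 < i.val) with h | h | h
      · simp [h]
      · simp [h]
      · rw [if_neg (by lia), if_neg (by lia), if_neg (by lia), if_neg (by lia), if_neg (by lia)]
        simp
    · rw [if_neg hk0]
      simp only [Pi.smul_apply, Sum.elim_inl]
      rcases (by lia : i.val = k ∨ i.val = k + 1 ∨ i.val + 1 = k ∨
        (i.val ≠ k ∧ i.val ≠ k + 1 ∧ i.val + 1 ≠ k)) with h | h | h | ⟨h, h', h''⟩
      · simp [h, show k ≠ k - 1 by lia]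
      · simp [h, show k + 1 ≠ k - 1 by lia, show k + 1 + 1 ≠ k by lia]
      · simp [← h, show i.val ≠ i.val + 1 + 1 by lia]
      · simp [h, h', h'', Ne.symm h', show i.val ≠ k - 1 by lia]
  · have e1 : ∀ r : ℕ, r ≤ m → siteVec m n r (Sum.inr j) = 0 := fun r hr => by
      simp [siteVec, show r ≠ m + 1 by lia]
    have e2 : (if k = 0 then (0 : Fin (m + 1) ⊕ Fin (n + 1) → ℂ)
        else √(w (k - 1)) • siteVec m n (k - 1)) (Sum.inr j) = 0 := by
      split_ifs
      · rfl
      · rw [Pi.smul_apply, e1 _ (by lia), smul_zero]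
    rw [Pi.add_apply, Pi.add_apply, e2, Pi.smul_apply, Pi.smul_apply, e1 k hk]
    simp only [siteVec, Sum.elim_inl, Sum.elim_inr, add_zero, smul_zero, Fin.val_last]
    by_cases hj : j = 0
    · subst hj
      by_cases hkm : k = m
      · subst hkm; simp
      · simp [hkm, Ne.symm hkm]
    · have : j.val ≠ 0 := fun h => hj (Fin.ext h)
      simp [hj]

lemma halfEnd_sumElim_zero {m n : ℕ} (α w : ℕ → ℝ) {C : Matrix (Fin (n + 1)) (Fin (n + 1)) ℂ}
    {v : Fin (n + 1) → ℂ} {l ρ : ℝ} (hv : C.mulVec v = (l : ℂ) • v) (hρ : v 0 = ρ) :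
    halfEnd α w C (Sum.elim 0 v : Fin (m + 1) ⊕ Fin (n + 1) → ℂ)
      = l • Sum.elim (0 : Fin (m + 1) → ℂ) v + (√(w m) * ρ) • siteVec m n m := by
  rw [halfEnd_apply, Sum.elim_comp_inl, Sum.elim_comp_inr, Matrix.mulVec_zero, hv]
  ext s
  rcases s with i | j
  · by_cases hi : i = Fin.last m
    · subst hi; simp [siteVec, hρ]
    · have : i.val ≠ m := fun h => hi (Fin.ext h)
      simp [siteVec, hi, this]
  · simp [siteVec]

/-- The secular polynomial of the half system annihilates the free end of the chain. -/
lemma halfEnd_secularPoly {m n : ℕ} {α w : ℕ → ℝ} (hw : ∀ k, 0 < w k)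
    {C : Matrix (Fin (n + 1)) (Fin (n + 1)) ℂ} {Λ : Finset ℝ} {ρ : ℝ → ℝ}
    {v : ℝ → Fin (n + 1) → ℂ} (hv : ∀ l, C.mulVec (v l) = (l : ℂ) • v l)
    (hρ : ∀ l, v l 0 = ρ l) (hsum : ∑ l ∈ Λ, v l = Pi.single 0 1) :
    aeval (halfEnd α w C) (secularPoly (nodePoly Λ) (stieltjesNum Λ ρ) (orthPoly α w (m + 1))
      (Polynomial.C (w m) * orthPoly α w m)) (siteVec m n 0) = 0 := by
  refine aeval_secularPoly_eq_zero (e := siteVec m n) (v := fun l => Sum.elim 0 (v l)) hw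
    ?_ (fun k hk => ?_) (fun l _ => halfEnd_sumElim_zero α w (hv l) (hρ l)) ?_
  · rw [halfEnd_siteVec α w C (Nat.zero_le m), if_pos rfl, add_zero]
  · rw [halfEnd_siteVec α w C hk, if_neg (Nat.succ_ne_zero k), Nat.add_sub_cancel]
  · ext s
    rw [Finset.sum_apply]
    rcases s with i | j
    · simp [siteVec, i.2.ne]
    · have := congrFun hsum j
      rw [Finset.sum_apply] at this
      simp [siteVec, this, Pi.single_apply]

/-- A polynomial of degree at most `m` of the half system keeps the excitation at the free end
inside the chain, and its effect does not depend on the system to which the chain is attached. -/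
lemma exists_aeval_halfEnd_eq {m n : ℕ} (α : ℕ → ℝ) {w : ℕ → ℝ} (hw : ∀ k, 0 < w k) {f : ℝ[X]}
    (hf0 : f ≠ 0) (hf : f.natDegree ≤ m) :
    ∃ x : Fin (m + 1) → ℂ, x ≠ 0 ∧ ∀ C : Matrix (Fin (n + 1)) (Fin (n + 1)) ℂ,
      aeval (halfEnd α w C) f (siteVec m n 0) = Sum.elim x 0 := by
  obtain ⟨c, hc, hcd⟩ := exists_eq_sum_orthPoly α w (le_refl f.natDegree)
  refine ⟨fun i => if i.val ≤ f.natDegree then (c i * couplingProd w i : ℝ) else 0, fun h => ?_,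
    fun C => ?_⟩
  · have h1 := congrFun h ⟨f.natDegree, by lia⟩
    simp only [le_refl, if_true, Pi.zero_apply, Complex.ofReal_eq_zero, hcd] at h1
    exact mul_ne_zero (Polynomial.leadingCoeff_ne_zero.2 hf0) (couplingProd_pos hw _).ne' h1
  · have key : ∀ k ≤ m, aeval (halfEnd α w C) (orthPoly α w k) (siteVec m n 0)
        = couplingProd w k • siteVec m n k := fun k hk => by
      refine aeval_orthPoly_chain (e := siteVec m n) (m := m) hw ?_ (fun k hk => ?_) (by lia)
      · rw [halfEnd_siteVec α w C (Nat.zero_le m), if_pos rfl, add_zero]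
      · rw [halfEnd_siteVec α w C hk, if_neg (Nat.succ_ne_zero k), Nat.add_sub_cancel]
    have h2 : aeval (halfEnd α w C) f (siteVec m n 0)
        = ∑ k ∈ Finset.range (f.natDegree + 1), (c k * couplingProd w k) • siteVec m n k := by
      conv_lhs => rw [hc]
      rw [map_sum, LinearMap.sum_apply]
      refine Finset.sum_congr rfl fun k hk => ?_
      rw [map_mul, Module.End.mul_apply, key k (by have := Finset.mem_range.1 hk; lia), aeval_C,
        Module.algebraMap_end_apply, smul_smul]
    rw [h2]
    ext s
    rw [Finset.sum_apply]
    rcases s with i | j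
    · simp only [Pi.smul_apply, siteVec, Sum.elim_inl, smul_ite, smul_zero]
      rw [Finset.sum_ite_eq]
      simp
    · refine Finset.sum_eq_zero fun k hk => ?_
      have hk' := Finset.mem_range.1 hk
      simp [siteVec, show k ≠ m + 1 by lia]

/-- A vector of fixed parity that is a sum of eigenvectors, on which the evolution has the common
phase `z`, is multiplied by `z`. -/
lemma exp_mulVec_withParity {m n : ℕ} {α w : ℕ → ℝ} (B : Matrix (Fin (n + 1)) (Fin (n + 1)) ℂ)
    (J' : ℝ) {σ : ℝ} (hσ : σ * σ = 1) {Y : Finset ℝ} {x : Fin (m + 1) ⊕ Fin (n + 1) → ℂ}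
    (hx : aeval (halfEnd α w (B + ((σ * J' : ℝ) : ℂ) • outProj (n + 1))) (nodePoly Y) x = 0)
    {c z : ℂ} (hz : ∀ y ∈ Y, Complex.exp (c * (y : ℝ)) = z) :
    (NormedSpace.exp (c • extendedH ((chainMatrix m α w).submatrix Fin.rev Fin.rev) B
      (√(w m)) J')).mulVec (withParity σ x) = z • withParity σ x := by
  obtain ⟨u, rfl, hu⟩ := exists_sum_eigenvectors hx
  have hlin : withParity σ (∑ y ∈ Y, u y) = ∑ y ∈ Y, withParity σ (u y) := by
    ext s
    rw [Finset.sum_apply]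
    rcases s with (i | i) | (i | i) <;> simp [withParity, Finset.mul_sum]
  rw [hlin, Matrix.mulVec_sum, Finset.smul_sum]
  refine Finset.sum_congr rfl fun y hy => ?_
  have h1 := hu y hy
  rw [halfEnd, LinearMap.restrictScalars_apply, Matrix.mulVecLin_apply] at h1
  rw [exp_smul_mulVec_of_eigenvector (l := ((y : ℝ) : ℂ)) ?_ c, hz y hy]
  rw [extendedH_mulVec_withParity _ _ _ _ hσ, h1]
  ext s
  rcases s with (i | i) | (i | i) <;> simp [withParity, mul_left_comm]

lemma subset_supportedSpectrum {n : ℕ} {C : Matrix (Fin (n + 1)) (Fin (n + 1)) ℂ} {Λ : Finset ℝ}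
    {ρ : ℝ → ℝ} {v : ℝ → Fin (n + 1) → ℂ} (hρ0 : ∀ l ∈ Λ, 0 < ρ l)
    (hv : ∀ l, C.mulVec (v l) = (l : ℂ) • v l) (hρ : ∀ l, v l 0 = ρ l) :
    (Λ : Set ℝ) ⊆ supportedSpectrum C := fun l hl =>
  ⟨v l, hv l, 0, rfl, by rw [hρ]; exact_mod_cast (hρ0 l hl).ne'⟩

lemma outProj_isHermitian (n : ℕ) : (outProj n).IsHermitian := by
  rw [outProj]
  refine Matrix.isHermitian_diagonal_of_self_adjoint _ ?_
  ext i
  rw [Pi.star_apply]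
  split_ifs <;> simp

end Reduction

/-! ### Perfect encoded transfer -/

theorem mainTheorem1 (b : ℕ) (hb : 0 < b) (B : Matrix (Fin b) (Fin b) ℂ) (hB : B.IsHermitian)
    (J' : ℝ) (hC : Disjoint (supportedSpectrum (Cplus B J')) (supportedSpectrum (Cminus B J'))) :
    ∃ (a : ℕ) (A : Matrix (Fin a) (Fin a) ℝ) (J : ℝ),
      0 < a ∧ IsTridiagonalChain A ∧ 0 < J ∧ PerfectEncodedTransfer (extendedH A B J J') := by
  obtain ⟨n, rfl⟩ : ∃ n, b = n + 1 := ⟨b - 1, by lia⟩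
  have hP : Cplus B J' = B + (((1 : ℝ) * J' : ℝ) : ℂ) • outProj (n + 1) := by
    rw [one_mul]; rfl
  have hM : Cminus B J' = B + (((-1 : ℝ) * J' : ℝ) : ℂ) • outProj (n + 1) := by
    rw [Cminus, neg_one_mul, Complex.ofReal_neg, neg_smul, sub_eq_add_neg]
  rw [hP, hM] at hC
  have hherm : ∀ r : ℝ, (B + (r : ℂ) • outProj (n + 1)).IsHermitian := fun r =>
    hB.add (by
      rw [Matrix.IsHermitian, Matrix.conjTranspose_smul, (outProj_isHermitian _).eq]
      simp)
  obtain ⟨Λp, ρp, vp, hρp, hvp, hvρp, hsump⟩ := exists_spectral_resolution (hherm (1 * J')) 0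
  obtain ⟨Λm, ρm, vm, hρm, hvm, hvρm, hsumm⟩ := exists_spectral_resolution (hherm (-1 * J')) 0
  have hdisj : Disjoint Λp Λm := Finset.disjoint_coe.1
    (hC.mono (subset_supportedSpectrum hρp hvp hvρp) (subset_supportedSpectrum hρm hvm hvρm))
  have hne : Λp.Nonempty := by
    rw [Finset.nonempty_iff_ne_empty]
    rintro rfl
    have := congrFun hsump 0
    simp at this
  obtain ⟨m, α, w, t, Yp, Ym, Fp, Fm, hw, ht, hEp, hEm, hF0, hFd, hYp, hYm⟩ :=
    exists_commensurate_chain hne hdisj hρp hρm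
  obtain ⟨x, hx0, hx⟩ := exists_aeval_halfEnd_eq (n := n) α hw hF0 hFd
  -- The factors `Fp`, `Fm` have removed from `x` the eigenvectors with uncontrolled eigenvalues.
  have hp : Polynomial.aeval (halfEnd α w (B + (((1 : ℝ) * J' : ℝ) : ℂ) • outProj (n + 1)))
      (nodePoly Yp) (Sum.elim x 0) = 0 := by
    rw [← hx, ← Module.End.mul_apply, ← map_mul,
      show nodePoly Yp * (Fp * Fm) = Fm * (nodePoly Yp * Fp) by ring, ← hEp, map_mul,
      Module.End.mul_apply, halfEnd_secularPoly hw hvp hvρp hsump, map_zero]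
  have hm : Polynomial.aeval (halfEnd α w (B + (((-1 : ℝ) * J' : ℝ) : ℂ) • outProj (n + 1)))
      (nodePoly Ym) (Sum.elim x 0) = 0 := by
    rw [← hx, ← Module.End.mul_apply, ← map_mul,
      show nodePoly Ym * (Fp * Fm) = Fp * (nodePoly Ym * Fm) by ring, ← hEm, map_mul,
      Module.End.mul_apply, halfEnd_secularPoly hw hvm hvρm hsumm, map_zero]
  have hep := exp_mulVec_withParity B J' (σ := 1) (by norm_num) hp hYp
  have hem := exp_mulVec_withParity B J' (σ := -1) (by norm_num) hm hYm
  set U := NormedSpace.exp (-(Complex.I * (t : ℂ)) •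
    extendedH ((chainMatrix m α w).submatrix Fin.rev Fin.rev) B (√(w m)) J') with hU
  -- The state on the chain is the mean of its extensions of even and of odd parity.
  set ψ : Site (m + 1) (n + 1) → ℂ := Sum.elim (Sum.elim x 0) 0 with hψ
  have hsplit : ψ = (2⁻¹ : ℂ) • (withParity 1 (Sum.elim x 0) + withParity (-1) (Sum.elim x 0)) := by
    ext s
    rcases s with (i | i) | (i | i) <;> simp [hψ, withParity]
    all_goals ring
  have hUψ : U.mulVec ψ = fun s => ψ (mirror s) := by
    rw [hsplit, Matrix.mulVec_smul, Matrix.mulVec_add, hep, hem]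
    ext s
    simp only [Pi.smul_apply, Pi.add_apply, withParity_mirror (show (1 : ℝ) * 1 = 1 by norm_num),
      withParity_mirror (show (-1 : ℝ) * -1 = 1 by norm_num), smul_eq_mul]
    push_cast
    ring
  have hnorm : 0 < ∑ s, ‖ψ s‖ ^ 2 := by
    obtain ⟨i, hi⟩ := Function.ne_iff.1 hx0
    refine Finset.sum_pos' (fun s _ => by positivity) ⟨Sum.inl (Sum.inl i), Finset.mem_univ _, ?_⟩
    exact pow_pos (norm_pos_iff.2 hi) 2
  set r : ℝ := (√(∑ s, ‖ψ s‖ ^ 2))⁻¹ with hr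
  refine ⟨m + 1, (chainMatrix m α w).submatrix Fin.rev Fin.rev, √(w m), Nat.succ_pos m,
    isTridiagonalChain_chainMatrix m α hw, Real.sqrt_pos.2 (hw m), t, 0, (r : ℂ) • ψ, ht, ?_, ?_,
    ?_⟩
  · have h1 : ∀ s, ‖((r : ℂ) • ψ) s‖ ^ 2 = r ^ 2 * ‖ψ s‖ ^ 2 := fun s => by
      rw [Pi.smul_apply, norm_smul, mul_pow, Complex.norm_real, Real.norm_eq_abs, sq_abs]
    simp only [h1]
    rw [← Finset.mul_sum, hr, inv_pow, Real.sq_sqrt hnorm.le, inv_mul_cancel₀ hnorm.ne']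
  · intro s hs
    rcases s with (i | i) | s
    · exact absurd ⟨i, rfl⟩ hs
    · simp [hψ]
    · simp [hψ]
  · rw [Complex.ofReal_zero, mul_zero, Complex.exp_zero, one_smul, ← hU, Matrix.mulVec_smul, hUψ]
    rfl
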